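/- **Corollary (controlling algebra of deformation maps of a matched pair).** Let $\mathbb K$ be a field of characteristic $\neq 2$; associative algebras over $\mathbb K$ are not assumed unital. Let $(A,A',\rho,\mu,\eta,\xi)$ be a matched pair of associative algebras over $\mathbb K$: $(A,\cdot_A)$ and $(A',\cdot_{A'})$ are associative algebras, $\rho,\mu:A\to\mathfrak{gl}(A')$ and $\eta,\xi:A'\to\mathfrak{gl}(A)$ are linear maps such that $(A';\rho,\mu)$ is a representation of $A$, i.e. $\rho(x\cdot_A y)=\rho(x)\rho(y)$, $\mu(x\cdot_A y)=\mu(y)\mu(x)$, $\rho(x)\mu(y)=\mu(y)\rho(x)$, likewise $(A;\eta,\xi)$ is a representation of $A'$, and for all $x,y\in A$, $u,v\in A'$ \begin{align*} \rho(x)(u\cdot_{A'}v)&=\rho(\xi(u)x)v+(\rho(x)u)\cdot_{A'}v, & \mu(x)(u\cdot_{A'}v)&=\mu(\eta(v)x)u+u\cdot_{A'}(\mu(x)v),\\ \eta(u)(x\cdot_{A}y)&=\eta(\mu(x)u)y+(\eta(u)x)\cdot_{A}y, & \xi(u)(x\cdot_{A}y)&=\xi(\rho(y)u)x+x\cdot_{A}(\xi(u)y),\\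 \rho(\eta(u)x)v+(\mu(x)u)\cdot_{A'} v&=\mu(\xi(v)x)u+u\cdot_{A'}(\rho(x)v), & \eta(\rho(x)u)y+(\xi(u)x)\cdot_{A} y&=\xi(\mu(y)u)x+x\cdot_{A}(\eta(u)y). \end{align*} A deformation map of the matched pair is a linear map $B:A'\to A$ such that for all $u,v\in A'$ $$B(u)\cdot_{A}B(v)+\xi(v)B(u)+\eta(u)B(v)=B\big(u\cdot_{A'} v+\rho(B(u))v+\mu(B(v))u\big).$$ Let $\mathfrak g=\bigoplus_{n\ge 0}\mathrm{Hom}(\otimes^{n+1}A',A)$ with $\mathrm{Hom}(\otimes^{n+1}A',A)$ in degree $n$, and let $s\mathfrak g$ be the shifted graded space, $(s\mathfrak g)^i=\mathfrak g^{i-1}$, so that $\mathrm{Hom}(\otimes^{m}A',A)$ has degree $m$ in $s\mathfrak g$. For $f_1\in\mathrm{Hom}(\otimes^{m_1}A',A)$, $f_2\in\mathrm{Hom}(\otimes^{m_2}A',A)$ define $[\![f_1,f_2]\!]\in\mathrm{Hom}(\otimes^{m_1+m_2}A',A)$ by \begin{align*} &[\![f_1,f_2]\!](u_1,\dots,u_{m_1+m_2})\\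 &=f_2(u_1,\dots,u_{m_2})\cdot_{A}f_1(u_{m_2+1},\dots,u_{m_1+m_2})-(-1)^{m_1m_2}f_1(u_1,\dots,u_{m_1})\cdot_{A}f_2(u_{m_1+1},\dots,u_{m_1+m_2})\\ &\quad+\sum_{i=1}^{m_1}(-1)^{im_2}f_1(u_1,\dots,u_{i-1},\mu(f_2(u_{i+1},\dots,u_{i+m_2}))u_i,u_{i+m_2+1},\dots,u_{m_1+m_2})\\ &\quad-\sum_{i=1}^{m_1}(-1)^{(i-1)m_2}f_1(u_1,\dots,u_{i-1},\rho(f_2(u_i,\dots,u_{i+m_2-1}))u_{i+m_2},u_{i+m_2+1},\dots,u_{m_1+m_2})\\ &\quad+(-1)^{m_1m_2}\sum_{i=1}^{m_2}(-1)^{(i-1)m_1}f_2(u_1,\dots,u_{i-1},\rho(f_1(u_i,\dots,u_{i+m_1-1}))u_{i+m_1},u_{i+m_1+1},\dots,u_{m_1+m_2})\\ &\quad-(-1)^{m_1(m_2+1)}\sum_{i=1}^{m_2}(-1)^{(i-1)m_1}f_2(u_1,\dots,u_{i-1},\mu(f_1(u_{i+1},\dots,u_{i+m_1}))u_i,u_{i+m_1+1},\dots,u_{m_1+m_2}),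 \end{align*} and for $f\in\mathrm{Hom}(\otimes^{m}A',A)$ define $\mathrm df\in\mathrm{Hom}(\otimes^{m+1}A',A)$ by \begin{align*} \mathrm df(u_1,\dots,u_{m+1})&=\xi(u_{m+1})f(u_1,\dots,u_m)+(-1)^{m-1}\eta(u_1)f(u_2,\dots,u_{m+1})\\ &\quad+(-1)^{m-1}\sum_{i=1}^m(-1)^if(u_1,\dots,u_{i-1},u_i\cdot_{A'}u_{i+1},u_{i+2},\dots,u_{m+1}). \end{align*} Then $(s\mathfrak g,[\![\cdot,\cdot]\!],\mathrm d)$, with the bilinear and linear extensions of these operations, is a differential graded Lie algebra: $[\![\cdot,\cdot]\!]$ has degree $0$, is graded skew-symmetric and satisfies the graded Jacobi identity, and $\mathrm d$ is a derivation of degree $1$ of the bracket with $\mathrm d^2=0$. Moreover, its Maurer–Cartan elements, i.e. the elements $x$ of degree $1$ with $\mathrm dx+\tfrac12[\![x,x]\!]=0$, are exactly the deformation maps of the matched pair $(A,A')$, regarded as elements of $\mathrm{Hom}(\otimes^1A',A)=\mathrm{Hom}(A',A)$. -/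

import Mathlib

/-! ### Matched pairs of associative algebras and their deformation maps

Associative algebras over a field are not assumed to have a unit: they are `NonUnitalRing`s with
a compatible vector space structure. -/

/-- A representation `(V; l, r)` of an associative algebra `A` on a vector space `V`. -/
structure IsAssocRep {K A V : Type*} [Field K]
    [NonUnitalRing A] [Module K A] [AddCommGroup V] [Module K V]
    (l r : A →ₗ[K] Module.End K V) : Prop where
  left_mul : ∀ x y : A, l (x * y) = l x ∘ₗ l y
  right_mul : ∀ x y : A, r (x * y) = r y ∘ₗ r x
  left_right : ∀ x y : A, l x ∘ₗ r y = r y ∘ₗ l x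

/-- A matched pair `(A, A', ρ, μ, η, ξ)` of associative algebras. -/
structure MatchedPair (K A A' : Type*) [Field K]
    [NonUnitalRing A] [Module K A] [NonUnitalRing A'] [Module K A'] where
  ρ : A →ₗ[K] Module.End K A'
  μ : A →ₗ[K] Module.End K A'
  η : A' →ₗ[K] Module.End K A
  ξ : A' →ₗ[K] Module.End K A
  rep : IsAssocRep ρ μ
  rep' : IsAssocRep η ξ
  ρ_mul : ∀ (x : A) (u v : A'), ρ x (u * v) = ρ (ξ u x) v + ρ x u * v
  μ_mul : ∀ (x : A) (u v : A'), μ x (u * v) = μ (η v x) u + u * μ x v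
  η_mul : ∀ (u : A') (x y : A), η u (x * y) = η (μ x u) y + η u x * y
  ξ_mul : ∀ (u : A') (x y : A), ξ u (x * y) = ξ (ρ y u) x + x * ξ u y
  mid : ∀ (x : A) (u v : A'), ρ (η u x) v + μ x u * v = μ (ξ v x) u + u * ρ x v
  mid' : ∀ (u : A') (x y : A), η (ρ x u) y + ξ u x * y = ξ (μ y u) x + x * η u y

/-- A deformation map of a matched pair `(A, A')`. -/
def MatchedPair.IsDeformationMap {K A A' : Type*} [Field K]
    [NonUnitalRing A] [Module K A] [NonUnitalRing A'] [Module K A']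
    (P : MatchedPair K A A') (B : A' →ₗ[K] A) : Prop :=
  ∀ u v : A', B u * B v + P.ξ v (B u) + P.η u (B v) =
    B (u * v + P.ρ (B u) v + P.μ (B v) u)

/-! ### Differential graded Lie algebras -/

/-- `(L, br, d)`, graded by the submodules `gr i` (`i : ℤ`), is a differential graded Lie algebra:
the bracket has degree `0` and the differential has degree `1`. -/
structure IsDGLieAlgebra {K L : Type*} [Field K] [AddCommGroup L] [Module K L]
    (gr : ℤ → Submodule K L) (br : L →ₗ[K] L →ₗ[K] L) (d : L →ₗ[K] L) : Prop where
  isInternal : DirectSum.IsInternal gr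
  bracket_mem : ∀ (i j : ℤ) (x y : L), x ∈ gr i → y ∈ gr j → br x y ∈ gr (i + j)
  skew : ∀ (i j : ℤ) (x y : L), x ∈ gr i → y ∈ gr j →
    br x y = -((-1 : K) ^ (i * j) • br y x)
  jacobi : ∀ (i j k : ℤ) (x y z : L), x ∈ gr i → y ∈ gr j → z ∈ gr k →
    br x (br y z) = br (br x y) z + (-1 : K) ^ (i * j) • br y (br x z)
  d_mem : ∀ (i : ℤ) (x : L), x ∈ gr i → d x ∈ gr (i + 1)
  d_d : ∀ x : L, d (d x) = 0
  leibniz : ∀ (i j : ℤ) (x y : L), x ∈ gr i → y ∈ gr j →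
    d (br x y) = br (d x) y + (-1 : K) ^ i • br x (d y)

/-- Maurer-Cartan elements of a differential graded Lie algebra: the elements `x` of degree `1`
with `d x + ½ [x, x] = 0`. -/
def IsMaurerCartan {K L : Type*} [Field K] [AddCommGroup L] [Module K L]
    (gr : ℤ → Submodule K L) (br : L →ₗ[K] L →ₗ[K] L) (d : L →ₗ[K] L) (x : L) : Prop :=
  x ∈ gr 1 ∧ d x + (2⁻¹ : K) • br x x = 0

/-! ### Multilinear maps -/

section Multilinear

variable {K : Type*} [Field K]
  {V W X Y : Type*} [AddCommGroup V] [Module K V] [AddCommGroup W] [Module K W]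
  [AddCommGroup X] [Module K X] [AddCommGroup Y] [Module K Y]

/-- `Hom(⊗ᵐ V, W)`. -/
abbrev Cochain (K V W : Type*) [Field K] [AddCommGroup V] [Module K V]
    [AddCommGroup W] [Module K W] (m : ℕ) : Type _ :=
  MultilinearMap K (fun _ : Fin m => V) W

/-- The identity of `V`, as an element of `Hom(⊗¹ V, V)`. -/
def idCochain (K V : Type*) [Field K] [AddCommGroup V] [Module K V] : Cochain K V V 1 :=
  MultilinearMap.ofSubsingleton K V V 0 LinearMap.id


theorem update_comp_apply_self {S : Type*} {m N : ℕ} (φ : Fin m → Fin N) (hφ : Function.Injective φ)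
    [DecidableEq (Fin N)] (u : Fin N → S) (j : Fin m) (z : S) :
    (fun l => Function.update u (φ j) z (φ l)) = Function.update (fun l => u (φ l)) j z := by
  funext l
  by_cases hl : l = j
  · subst hl; simp
  · rw [Function.update_of_ne hl, Function.update_of_ne (fun h => hl (hφ h))]

theorem update_comp_of_ne {S : Type*} {m N : ℕ} (φ : Fin m → Fin N) [DecidableEq (Fin N)]
    (u : Fin N → S) (k : Fin N) (hk : ∀ l, φ l ≠ k) (z : S) :
    (fun l => Function.update u k z (φ l)) = fun l => u (φ l) := by
  funext l
  rw [Function.update_of_ne (hk l)]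

/-- For a bilinear map `b`, the cochain
`(u₁, …, u_{m+n}) ↦ b (f (u₁, …, u_m)) (g (u_{m+1}, …, u_{m+n}))`, where `N = m + n`. -/
def pairing (b : W →ₗ[K] X →ₗ[K] Y) {m n N : ℕ} (h : N = m + n)
    (f : Cochain K V W m) (g : Cochain K V X n) : Cochain K V Y N where
  toFun u := b (f fun i => u ⟨i, by omega⟩) (g fun j => u ⟨m + j, by omega⟩)
  map_update_add' := by
    intro _ u k x y
    let φ : Fin m → Fin N := fun i => ⟨i, by omega⟩
    let ψ : Fin n → Fin N := fun j => ⟨m + j, by omega⟩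
    have hφ : Function.Injective φ := fun a c hac => by simpa [φ, Fin.ext_iff] using hac
    have hψ : Function.Injective ψ := fun a c hac => by simpa [ψ, Fin.ext_iff] using hac
    change b (f fun i => Function.update u k (x + y) (φ i))
        (g fun i => Function.update u k (x + y) (ψ i)) =
      b (f fun i => Function.update u k x (φ i)) (g fun i => Function.update u k x (ψ i)) +
      b (f fun i => Function.update u k y (φ i)) (g fun i => Function.update u k y (ψ i))
    by_cases hk : (k : ℕ) < m
    · obtain ⟨j, rfl⟩ : ∃ j, φ j = k := ⟨⟨k, hk⟩, rfl⟩
      have hne : ∀ l, ψ l ≠ φ j := fun l hl => by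
        simp only [ψ, φ, Fin.ext_iff] at hl; omega
      simp only [update_comp_apply_self φ hφ, update_comp_of_ne ψ u _ hne, MultilinearMap.map_update_add,
        map_add, LinearMap.add_apply]
    · obtain ⟨j, rfl⟩ : ∃ j, ψ j = k :=
        ⟨⟨k - m, by omega⟩, by simp only [ψ, Fin.ext_iff]; omega⟩
      have hne : ∀ l, φ l ≠ ψ j := fun l hl => by
        simp only [ψ, φ, Fin.ext_iff] at hl; omega
      simp only [update_comp_apply_self ψ hψ, update_comp_of_ne φ u _ hne, MultilinearMap.map_update_add, map_add]
  map_update_smul' := by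
    intro _ u k c x
    let φ : Fin m → Fin N := fun i => ⟨i, by omega⟩
    let ψ : Fin n → Fin N := fun j => ⟨m + j, by omega⟩
    have hφ : Function.Injective φ := fun a c hac => by simpa [φ, Fin.ext_iff] using hac
    have hψ : Function.Injective ψ := fun a c hac => by simpa [ψ, Fin.ext_iff] using hac
    change b (f fun i => Function.update u k (c • x) (φ i))
        (g fun i => Function.update u k (c • x) (ψ i)) =
      c • b (f fun i => Function.update u k x (φ i)) (g fun i => Function.update u k x (ψ i))
    by_cases hk : (k : ℕ) < m
    · obtain ⟨j, rfl⟩ : ∃ j, φ j = k := ⟨⟨k, hk⟩, rfl⟩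
      have hne : ∀ l, ψ l ≠ φ j := fun l hl => by
        simp only [ψ, φ, Fin.ext_iff] at hl; omega
      simp only [update_comp_apply_self φ hφ, update_comp_of_ne ψ u _ hne, MultilinearMap.map_update_smul,
        map_smul, LinearMap.smul_apply]
    · obtain ⟨j, rfl⟩ : ∃ j, ψ j = k :=
        ⟨⟨k - m, by omega⟩, by simp only [ψ, Fin.ext_iff]; omega⟩
      have hne : ∀ l, φ l ≠ ψ j := fun l hl => by
        simp only [ψ, φ, Fin.ext_iff] at hl; omega
      simp only [update_comp_apply_self ψ hψ, update_comp_of_ne φ u _ hne, MultilinearMap.map_update_smul, map_smul]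

/-- The arguments of `f` in `insertAt`: away from `i`, they are the entries of `u` that are not
arguments of `g`; the entry number `i` is `w`. -/
def insertArgs {S : Type*} {m k N : ℕ} (h : N = m + k) (i : Fin m)
    (u : Fin N → S) (w : S) : Fin m → S :=
  Function.update
    (fun j : Fin m => if j < i then u ⟨j, by omega⟩ else u ⟨j + k, by omega⟩) i w

theorem insertArgs_update {S : Type*} {m k N : ℕ} (h : N = m + k) (i : Fin m)
    [DecidableEq (Fin N)] (u : Fin N → S) (t : Fin N) :
    (∃ j : Fin m, j ≠ i ∧
      (∀ z w, insertArgs h i (Function.update u t z) w =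
        Function.update (insertArgs h i u w) j z) ∧
      ∀ (l : Fin (k + 1)), (⟨i + l, by omega⟩ : Fin N) ≠ t) ∨
    ((∃ l : Fin (k + 1), (⟨i + l, by omega⟩ : Fin N) = t) ∧
      ∀ z w, insertArgs h i (Function.update u t z) w = insertArgs h i u w) := by
  by_cases h1 : (t : ℕ) < i
  · refine Or.inl ⟨⟨t, by omega⟩, fun hh => ?_, fun z w => ?_, fun l hl => ?_⟩
    · simp only [Fin.ext_iff] at hh; omega
    · funext j
      simp only [insertArgs, Function.update_apply, Fin.ext_iff, Fin.lt_def]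
      split_ifs <;> first | rfl | omega
    · simp only [Fin.ext_iff] at hl; omega
  · by_cases h2 : (t : ℕ) ≤ i + k
    · refine Or.inr ⟨⟨⟨t - i, by omega⟩, by simp only [Fin.ext_iff]; omega⟩, fun z w => ?_⟩
      funext j
      simp only [insertArgs, Function.update_apply, Fin.ext_iff, Fin.lt_def]
      split_ifs <;> first | rfl | omega
    · refine Or.inl ⟨⟨t - k, by omega⟩, fun hh => ?_, fun z w => ?_, fun l hl => ?_⟩
      · simp only [Fin.ext_iff] at hh; omega
      · funext j
        simp only [insertArgs, Function.update_apply, Fin.ext_iff, Fin.lt_def]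
        split_ifs <;> first | rfl | omega
      · simp only [Fin.ext_iff] at hl; omega

/-- The cochain `(u₁, …, u_{m+k}) ↦ f (u₁, …, u_i, g (u_{i+1}, …, u_{i+k+1}), u_{i+k+2}, …)`
obtained by inserting `g`, which has `k + 1` arguments, into the argument of `f` with the
(zero-based) number `i`; here `N = m + k`. -/
def insertAt {m k N : ℕ} (h : N = m + k) (i : Fin m)
    (f : Cochain K V W m) (g : Cochain K V V (k + 1)) : Cochain K V W N where
  toFun u := f (insertArgs h i u (g fun l => u ⟨i + l, by omega⟩))
  map_update_add' := by
    intro _ u t x y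
    let ψ : Fin (k + 1) → Fin N := fun l => ⟨i + l, by omega⟩
    have hψ : Function.Injective ψ := fun a c hac => by simpa [ψ, Fin.ext_iff] using hac
    change f (insertArgs h i (Function.update u t (x + y))
        (g fun l => Function.update u t (x + y) (ψ l))) =
      f (insertArgs h i (Function.update u t x) (g fun l => Function.update u t x (ψ l))) +
      f (insertArgs h i (Function.update u t y) (g fun l => Function.update u t y (ψ l)))
    rcases insertArgs_update h i u t with ⟨j, _, hj, hne⟩ | ⟨⟨l, hl⟩, hi⟩
    · simp only [update_comp_of_ne ψ u t hne, hj, MultilinearMap.map_update_add]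
    · obtain rfl : ψ l = t := hl
      simp only [hi]
      simp only [insertArgs, update_comp_apply_self ψ hψ, MultilinearMap.map_update_add]
  map_update_smul' := by
    intro _ u t c x
    let ψ : Fin (k + 1) → Fin N := fun l => ⟨i + l, by omega⟩
    have hψ : Function.Injective ψ := fun a c hac => by simpa [ψ, Fin.ext_iff] using hac
    change f (insertArgs h i (Function.update u t (c • x))
        (g fun l => Function.update u t (c • x) (ψ l))) =
      c • f (insertArgs h i (Function.update u t x) (g fun l => Function.update u t x (ψ l)))
    rcases insertArgs_update h i u t with ⟨j, _, hj, hne⟩ | ⟨⟨l, hl⟩, hi⟩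
    · simp only [update_comp_of_ne ψ u t hne, hj, MultilinearMap.map_update_smul]
    · obtain rfl : ψ l = t := hl
      simp only [hi]
      simp only [insertArgs, update_comp_apply_self ψ hψ, MultilinearMap.map_update_smul]

theorem pairing_add_left (b : W →ₗ[K] X →ₗ[K] Y) {m n N : ℕ} (h : N = m + n)
    (f f' : Cochain K V W m) (g : Cochain K V X n) :
    pairing b h (f + f') g = pairing b h f g + pairing b h f' g := by
  ext u; simp [pairing]

theorem pairing_add_right (b : W →ₗ[K] X →ₗ[K] Y) {m n N : ℕ} (h : N = m + n)
    (f : Cochain K V W m) (g g' : Cochain K V X n) :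
    pairing b h f (g + g') = pairing b h f g + pairing b h f g' := by
  ext u; simp [pairing]

theorem pairing_smul_left (b : W →ₗ[K] X →ₗ[K] Y) {m n N : ℕ} (h : N = m + n) (c : K)
    (f : Cochain K V W m) (g : Cochain K V X n) :
    pairing b h (c • f) g = c • pairing b h f g := by
  ext u; simp [pairing]

theorem pairing_smul_right (b : W →ₗ[K] X →ₗ[K] Y) {m n N : ℕ} (h : N = m + n) (c : K)
    (f : Cochain K V W m) (g : Cochain K V X n) :
    pairing b h f (c • g) = c • pairing b h f g := by
  ext u; simp [pairing]

theorem insertAt_add_left {m k N : ℕ} (h : N = m + k) (i : Fin m)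
    (f f' : Cochain K V W m) (g : Cochain K V V (k + 1)) :
    insertAt h i (f + f') g = insertAt h i f g + insertAt h i f' g := by
  ext u; simp [insertAt]

theorem insertAt_add_right {m k N : ℕ} (h : N = m + k) (i : Fin m)
    (f : Cochain K V W m) (g g' : Cochain K V V (k + 1)) :
    insertAt h i f (g + g') = insertAt h i f g + insertAt h i f g' := by
  ext u; simp [insertAt, insertArgs]

theorem insertAt_smul_left {m k N : ℕ} (h : N = m + k) (i : Fin m) (c : K)
    (f : Cochain K V W m) (g : Cochain K V V (k + 1)) :
    insertAt h i (c • f) g = c • insertAt h i f g := by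
  ext u; simp [insertAt]

theorem insertAt_smul_right {m k N : ℕ} (h : N = m + k) (i : Fin m) (c : K)
    (f : Cochain K V W m) (g : Cochain K V V (k + 1)) :
    insertAt h i f (c • g) = c • insertAt h i f g := by
  ext u; simp [insertAt, insertArgs]

end Multilinear

/-! ### The controlling algebra -/

namespace MatchedPair

variable {K A A' : Type*} [Field K]
  [NonUnitalRing A] [Module K A] [IsScalarTower K A A] [SMulCommClass K A A]
  [NonUnitalRing A'] [Module K A'] [IsScalarTower K A' A'] [SMulCommClass K A' A']

/-- The cochain `(u₁, …, u_{m+1}) ↦ ρ (f (u₁, …, u_m)) u_{m+1}`. -/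
def rhoCochain (P : MatchedPair K A A') {m : ℕ} (f : Cochain K A' A m) :
    Cochain K A' A' (m + 1) :=
  pairing P.ρ rfl f (idCochain K A')

/-- The cochain `(u₁, …, u_{m+1}) ↦ μ (f (u₂, …, u_{m+1})) u₁`. -/
def muCochain (P : MatchedPair K A A') {m : ℕ} (f : Cochain K A' A m) :
    Cochain K A' A' (m + 1) :=
  pairing P.μ.flip (Nat.add_comm m 1) (idCochain K A') f

/-- The bracket of `f₁ ∈ Hom(⊗^{m₁} A', A)` and `f₂ ∈ Hom(⊗^{m₂} A', A)`, an element of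
`Hom(⊗^{m₁+m₂} A', A)`. The index `i` of the sums is zero-based. -/
def bracket (P : MatchedPair K A A') {m₁ m₂ N : ℕ} (h : N = m₁ + m₂)
    (f₁ : Cochain K A' A m₁) (f₂ : Cochain K A' A m₂) : Cochain K A' A N :=
  pairing (LinearMap.mul K A) (h.trans (Nat.add_comm m₁ m₂)) f₂ f₁
  - (-1 : K) ^ (m₁ * m₂) • pairing (LinearMap.mul K A) h f₁ f₂
  + ∑ i : Fin m₁, (-1 : K) ^ (((i : ℕ) + 1) * m₂) • insertAt h i f₁ (P.muCochain f₂)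
  - ∑ i : Fin m₁, (-1 : K) ^ ((i : ℕ) * m₂) • insertAt h i f₁ (P.rhoCochain f₂)
  + (-1 : K) ^ (m₁ * m₂) • ∑ i : Fin m₂, (-1 : K) ^ ((i : ℕ) * m₁) •
      insertAt (h.trans (Nat.add_comm m₁ m₂)) i f₂ (P.rhoCochain f₁)
  - (-1 : K) ^ (m₁ * (m₂ + 1)) • ∑ i : Fin m₂, (-1 : K) ^ ((i : ℕ) * m₁) •
      insertAt (h.trans (Nat.add_comm m₁ m₂)) i f₂ (P.muCochain f₁)

/-- The differential of `f ∈ Hom(⊗^{n+1} A', A)`, with `m = n + 1` arguments, an element of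
`Hom(⊗^{n+2} A', A)`. The index `i` of the sum is zero-based. -/
def differential (P : MatchedPair K A A') {n : ℕ} (f : Cochain K A' A (n + 1)) :
    Cochain K A' A (n + 2) :=
  pairing P.ξ.flip rfl f (idCochain K A')
  + (-1 : K) ^ n • pairing P.η (Nat.add_comm (n + 1) 1) (idCochain K A') f
  + (-1 : K) ^ n • ∑ i : Fin (n + 1), (-1 : K) ^ ((i : ℕ) + 1) •
      insertAt rfl i f
        (pairing (LinearMap.mul K A') rfl (idCochain K A') (idCochain K A'))

/-- The vector space `⊕_{n ≥ 0} Hom(⊗^{n+1} A', A)`. -/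
abbrev ControlSpace (K A A' : Type*) [Field K]
    [NonUnitalRing A] [Module K A] [NonUnitalRing A'] [Module K A'] : Type _ :=
  DirectSum ℕ fun n => Cochain K A' A (n + 1)

/-- The grading of `s(⊕_{n ≥ 0} Hom(⊗^{n+1} A', A))`: before the shift `s`, the elements of
`Hom(⊗^{n+1} A', A)` have degree `n`, and the component of degree `i` of the shifted space is the
one of degree `i - 1` of the space itself. -/
def controlGrading (K A A' : Type*) [Field K]
    [NonUnitalRing A] [Module K A] [NonUnitalRing A'] [Module K A'] (i : ℤ) :
    Submodule K (ControlSpace K A A') where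
  carrier := {x | ∀ n : ℕ, (n : ℤ) ≠ i - 1 → x n = 0}
  add_mem' hx hy n hn := by simp [hx n hn, hy n hn]
  zero_mem' n _ := by simp
  smul_mem' c x hx n hn := by
    rw [DirectSum.smul_apply, hx n hn, smul_zero]

/-- `bracket` as a bilinear map. -/
def bracketHom (P : MatchedPair K A A') {m₁ m₂ N : ℕ} (h : N = m₁ + m₂) :
    Cochain K A' A m₁ →ₗ[K] Cochain K A' A m₂ →ₗ[K] Cochain K A' A N :=
  LinearMap.mk₂ K (fun f₁ f₂ => P.bracket h f₁ f₂)
    (fun f f' g => by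
      simp only [bracket, rhoCochain, muCochain, pairing_add_left, pairing_add_right,
        insertAt_add_left, insertAt_add_right, smul_add, Finset.sum_add_distrib]
      abel)
    (fun c f g => by
      simp only [bracket, rhoCochain, muCochain, pairing_smul_left, pairing_smul_right,
        insertAt_smul_left, insertAt_smul_right, smul_add, smul_sub, Finset.smul_sum,
        smul_comm c])
    (fun f g g' => by
      simp only [bracket, rhoCochain, muCochain, pairing_add_left, pairing_add_right,
        insertAt_add_left, insertAt_add_right, smul_add, Finset.sum_add_distrib]
      abel)
    (fun c f g => by
      simp only [bracket, rhoCochain, muCochain, pairing_smul_left, pairing_smul_right,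
        insertAt_smul_left, insertAt_smul_right, smul_add, smul_sub, Finset.smul_sum,
        smul_comm c])

/-- `differential` as a linear map. -/
def differentialHom (P : MatchedPair K A A') (n : ℕ) :
    Cochain K A' A (n + 1) →ₗ[K] Cochain K A' A (n + 2) where
  toFun f := P.differential f
  map_add' f f' := by
    simp only [differential, pairing_add_left, pairing_add_right, insertAt_add_left, smul_add,
      Finset.sum_add_distrib]
    abel
  map_smul' c f := by
    simp only [differential, pairing_smul_left, pairing_smul_right, insertAt_smul_left, smul_add,
      Finset.smul_sum, smul_comm c, RingHom.id_apply]

/-- The bilinear extension of `bracket` to the direct sum. -/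
def controlBracket (P : MatchedPair K A A') :
    ControlSpace K A A' →ₗ[K] ControlSpace K A A' →ₗ[K] ControlSpace K A A' :=
  DirectSum.toModule K ℕ _ fun p => LinearMap.flip <| DirectSum.toModule K ℕ _ fun q =>
    LinearMap.flip <| (P.bracketHom (N := p + q + 1 + 1) (by omega)).compr₂
      (DirectSum.lof K ℕ (fun n => Cochain K A' A (n + 1)) (p + q + 1))

/-- The linear extension of `differential` to the direct sum. -/
def controlDifferential (P : MatchedPair K A A') :
    ControlSpace K A A' →ₗ[K] ControlSpace K A A' :=
  DirectSum.toModule K ℕ _ fun n =>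
    DirectSum.lof K ℕ (fun n => Cochain K A' A (n + 1)) (n + 1) ∘ₗ P.differentialHom n

/-- A linear map `A' → A`, as an element of the summand `Hom(⊗¹ A', A)`. -/
def ofLinearMap (B : A' →ₗ[K] A) : ControlSpace K A A' :=
  DirectSum.lof K ℕ (fun n => Cochain K A' A (n + 1)) 0
    (MultilinearMap.ofSubsingleton K A' A (0 : Fin 1) B : Cochain K A' A 1)

end MatchedPair

set_option linter.unusedSectionVars false

/-! ### Cochains as functions on lists -/

section ListCochains

variable {K : Type*} [Field K]
  {V W X Y Z : Type*} [AddCommGroup W] [Module K W]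
  [AddCommGroup X] [Module K X] [AddCommGroup Y] [Module K Y] [AddCommGroup Z] [Module K Z]

/-! The matched pair axioms say that the bicrossed product `A ⋈ A'` on `A × A'` is associative
(`bicrossedMul_assoc`). Hence functions with values in `A × A'` have an associative cup product, and
the inclusion `i` of `A'` is an element of arity one. The graded commutator of an `A`-valued cochain
`f` of arity `m` with `i` has two components. The `A'`-component `adRight` is `ρ(f) - (-1)^m μ(f)`,
and the `A`-component `adLeft` collects the `ξ` and `η` terms. Thus the bracket is a graded cup
commutator plus insertions of `adRight f` into `g` and of `adRight g` into `f`, and the differential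
is `adLeft` plus insertion of the product of `A'`.

Everything then follows from three rules. Insertion is a graded derivation of the cup product
(`listCirc_bind`, `listCirc_cup`). Insertion satisfies the graded pre-Lie identity
(`listCirc_preLie`), so inserting a graded commutator is the graded commutator of the insertions.
Finally, the commutator with `i` is a graded derivation, and it commutes with an insertion up to the
commutator with the inserted function (`ad_mul`, `listCirc_ad`), because inserting into `i` returns
the inserted function. It follows that `adRight` sends brackets to commutators of insertions
(`adRight_listBracket`) and the differential to a commutator with the product of `A'`
(`adRight_listDifferential`). The Jacobi identity, the Leibniz rule and `d² = 0` become
cancellations of signed terms.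

Cochains are handled as functions on lists, extended by zero to wrong lengths. Insertion is then a
recursion on the head of the list, and sums of arities need no casts between types. -/

/-- A function on lists has arity `m` if it vanishes on lists of length different from `m`. -/
def HasArity (m : ℕ) (f : List V → W) : Prop := ∀ l : List V, l.length ≠ m → f l = 0

theorem HasArity.cons {m : ℕ} {f : List V → W} (hf : HasArity (m + 1) f) (u : V) :
    HasArity m fun l => f (u :: l) :=
  fun l hl => hf (u :: l) (by simpa using hl)

/-- The product of functions on lists induced by a bilinear map, the first factor taking `m`
arguments. -/
def listCup (b : X →ₗ[K] Y →ₗ[K] Z) (m : ℕ) :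
    (List V → X) →ₗ[K] (List V → Y) →ₗ[K] (List V → Z) :=
  LinearMap.mk₂ K (fun f g l => b (f (l.take m)) (g (l.drop m)))
    (fun _ _ _ => by ext; simp) (fun _ _ _ => by ext; simp)
    (fun _ _ _ => by ext; simp) (fun _ _ _ => by ext; simp)

theorem listCup_apply (b : X →ₗ[K] Y →ₗ[K] Z) (m : ℕ) (f : List V → X) (g : List V → Y)
    (l : List V) : listCup b m f g l = b (f (l.take m)) (g (l.drop m)) := rfl

theorem listCup_assoc (b : X →ₗ[K] X →ₗ[K] X) (hb : ∀ x y z, b (b x y) z = b x (b y z))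
    (m n : ℕ) (f g h : List V → X) :
    listCup b (m + n) (listCup b m f g) h = listCup b m f (listCup b n g h) := by
  ext l
  simp [listCup_apply, hb, List.take_take, List.drop_take]

/-- The value at a list of the sum of the insertions of `g`, which takes `k + 1` arguments,
into the entries of a function on lists. -/
def listCircAt (W : Type*) [AddCommGroup W] [Module K W] (k : ℕ) (g : List V → V) :
    List V → (List V → W) →ₗ[K] W
  | [] => 0
  | u :: l => LinearMap.proj (g (u :: l.take k) :: l.drop k) +
      (-1 : K) ^ k • (listCircAt W k g l ∘ₗ LinearMap.funLeft K W (List.cons u))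

/-- The circle product with a function `g` on lists, which takes `k + 1` arguments. -/
def listCirc (k : ℕ) (g : List V → V) : (List V → W) →ₗ[K] (List V → W) :=
  LinearMap.pi (listCircAt W k g)

theorem listCirc_nil (k : ℕ) (g : List V → V) (f : List V → W) :
    listCirc (K := K) k g f [] = 0 := rfl

theorem listCirc_cons (k : ℕ) (g : List V → V) (f : List V → W) (u : V) (l : List V) :
    listCirc (K := K) k g f (u :: l) = f (g (u :: l.take k) :: l.drop k) +
      (-1 : K) ^ k • listCirc (K := K) k g (fun c => f (u :: c)) l := rfl

theorem listCirc_of_hasArity_zero (k : ℕ) (g : List V → V) {f : List V → W}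
    (hf : HasArity 0 f) : listCirc (K := K) k g f = 0 := by
  suffices ∀ (l : List V) (f : List V → W), HasArity 0 f → listCirc (K := K) k g f l = 0 from
    funext fun l => this l f hf
  intro l
  induction l with
  | nil => intros; rfl
  | cons u l ih =>
    intro f hf
    rw [listCirc_cons, ih _ fun c _ => hf _ (by simp), hf _ (by simp)]
    simp

/-- Insertion changes only the arguments, so it commutes with linear maps applied to the values. It
therefore respects the embeddings of `A` and `A'` into `A × A'` and the projections back. -/
theorem listCirc_compLeft (k : ℕ) (g : List V → V) (φ : W →ₗ[K] X) (f : List V → W) :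
    listCirc (K := K) k g (φ.compLeft _ f) = φ.compLeft _ (listCirc (K := K) k g f) := by
  ext l
  induction l generalizing f with
  | nil => simp [listCirc_nil]
  | cons u l ih =>
    have := ih fun c => f (u :: c)
    simp only [LinearMap.compLeft_apply, Function.comp_apply] at this
    simp only [listCirc_cons, LinearMap.compLeft_apply, Function.comp_apply, map_add, map_smul,
      ← this]
    rfl

/-- The circle product is a graded derivation of dependent products. -/
theorem listCirc_bind (k m : ℕ) (h : List V → V) {g : List V → X} (hg : HasArity m g)
    (F : X →ₗ[K] (List V → W)) (l : List V) :
    listCirc (K := K) k h (fun l => F (g (l.take m)) (l.drop m)) l =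
      F (listCirc (K := K) k h g (l.take (m + k))) (l.drop (m + k)) +
      (-1 : K) ^ (m * k) • listCirc (K := K) k h (F (g (l.take m))) (l.drop m) := by
  induction l generalizing m g with
  | nil => simp [listCirc_nil]
  | cons u l ih =>
    cases m with
    -- A function of arity zero has no entry to insert into, so only the second summand survives.
    | zero => simp [listCirc_of_hasArity_zero k h hg]
    | succ m =>
      have := ih m (hg.cons u)
      simp only [listCirc_cons, List.take_succ_cons, List.drop_succ_cons, this,
        show m + 1 + k = (m + k) + 1 by omega, map_add, map_smul, Pi.add_apply, Pi.smul_apply,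
        List.take_take, List.drop_take, List.drop_drop, smul_add, smul_smul, ← pow_add]
      rw [show min k (m + k) = k by omega, show m + k - k = m by omega,
        show k + m * k = (m + 1) * k by ring, Nat.add_comm k m]
      abel

/-- The case `F x c = b x (g c)` of `listCirc_bind`, where the second factor does not depend on the
first. -/
theorem listCirc_cup (b : X →ₗ[K] Y →ₗ[K] Z) (k m : ℕ) (h : List V → V) {f : List V → X}
    (hf : HasArity m f) (g : List V → Y) :
    listCirc (K := K) k h (listCup b m f g) =
      listCup b (m + k) (listCirc (K := K) k h f) g +
      (-1 : K) ^ (m * k) • listCup b m f (listCirc (K := K) k h g) := by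
  ext l
  let F : X →ₗ[K] (List V → Z) := LinearMap.pi fun c => b.flip (g c)
  have h1 := listCirc_bind k m h hf F l
  have h2 := listCirc_compLeft k h (b (f (l.take m))) g
  have h3 : listCirc (K := K) k h (F (f (l.take m))) (l.drop m) =
      b (f (l.take m)) (listCirc (K := K) k h g (l.drop m)) := congrFun h2 _
  rw [h3] at h1
  exact h1

variable [AddCommGroup V] [Module K V]

/-- A function on lists is multilinear if it is linear in every entry. -/
structure ListMultilinear (K : Type*) [Field K] {V W : Type*} [AddCommGroup V] [Module K V]
    [AddCommGroup W] [Module K W] (f : List V → W) : Prop where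
  map_add : ∀ a x y b, f (a ++ (x + y) :: b) = f (a ++ x :: b) + f (a ++ y :: b)
  map_smul : ∀ a (c : K) x b, f (a ++ (c • x) :: b) = c • f (a ++ x :: b)

/-- The entry of the head of a multilinear function on lists. -/
def ListMultilinear.headMap {f : List V → W} (hf : ListMultilinear K f) :
    V →ₗ[K] (List V → W) where
  toFun x c := f (x :: c)
  map_add' x y := funext fun c => hf.map_add [] x y c
  map_smul' r x := funext fun c => hf.map_smul [] r x c

theorem ListMultilinear.cons {f : List V → W} (hf : ListMultilinear K f) (u : V) :
    ListMultilinear K fun l => f (u :: l) :=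
  ⟨fun a x y b => hf.map_add (u :: a) x y b, fun a c x b => hf.map_smul (u :: a) c x b⟩

/-- The graded pre-Lie identity. -/
theorem listCirc_preLie (k k' : ℕ) {g h : List V → V} (hg : HasArity (k + 1) g)
    (hh : HasArity (k' + 1) h) {f : List V → W} (hf : ListMultilinear K f) :
    listCirc (K := K) k' h (listCirc (K := K) k g f) -
        listCirc (K := K) (k + k') (listCirc (K := K) k' h g) f =
      (-1 : K) ^ (k * k') • (listCirc (K := K) k g (listCirc (K := K) k' h f) -
        listCirc (K := K) (k + k') (listCirc (K := K) k g h) f) := by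
  -- Subtracting the insertion of `h` into `g` leaves the terms where `g` and `h` fill different
  -- entries of `f`. They are sorted by whether the head `u` is an argument of `h`, of `g`, or of
  -- neither. Exchanging `g` and `h` swaps the first two kinds up to the sign `(-1)^(k * k')`; the
  -- third is left to the induction.
  have key : ∀ (k k' : ℕ) {g h : List V → V} (_ : HasArity (k + 1) g)
      {f : List V → W} (_ : ListMultilinear K f) (u : V) (l : List V),
      listCirc (K := K) k' h (listCirc (K := K) k g f) (u :: l) -
        listCirc (K := K) (k + k') (listCirc (K := K) k' h g) f (u :: l) =
      (-1 : K) ^ k • listCirc (K := K) k g (fun c => f (h (u :: l.take k') :: c)) (l.drop k') +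
      (-1 : K) ^ (k' + k * k') •
        listCirc (K := K) k' h (fun c => f (g (u :: l.take k) :: c)) (l.drop k) +
      (-1 : K) ^ (k + k') •
        (listCirc (K := K) k' h (listCirc (K := K) k g (fun c => f (u :: c))) l -
          listCirc (K := K) (k + k') (listCirc (K := K) k' h g) (fun c => f (u :: c)) l) := by
    intro k k' g h hg f hf u l
    have e1 : (fun c => listCirc (K := K) k g f (u :: c)) =
        (fun l => hf.headMap (g (u :: l.take k)) (l.drop k)) +
        (-1 : K) ^ k • listCirc (K := K) k g (fun c => f (u :: c)) := by
      ext c; rfl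
    -- Here the dependent form is needed: the value of `g` is itself the head entry of `f`.
    have e2 := listCirc_bind k' k h (hg.cons u) hf.headMap l
    rw [listCirc_cons k', e1, map_add, map_smul, Pi.add_apply, e2, listCirc_cons k,
      listCirc_cons (k + k'), listCirc_cons k']
    have e3 : ∀ (x y : V) (c : K) (b : List V), f ((x + c • y) :: b) = f (x :: b) + c • f (y :: b) :=
      fun x y c b => by
        have h1 := hf.map_add [] x (c • y) b
        have h2 := hf.map_smul [] c y b
        simp only [List.nil_append] at h1 h2
        rw [h1, h2]
    rw [e3]
    simp only [List.take_take, List.drop_take, List.drop_drop, Pi.smul_apply,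
      show min k' (k + k') = k' by omega, show k + k' - k' = k by omega, Nat.add_comm k' k,
      ListMultilinear.headMap, LinearMap.coe_mk, AddHom.coe_mk, smul_add, smul_sub, smul_smul,
      ← pow_add]
    abel
  ext l
  induction l generalizing f with
  | nil => simp [listCirc_nil]
  | cons u l ih =>
    have ih := ih (hf.cons u)
    have h1 := key k k' hg (h := h) hf u l
    have h2 := key k' k hh (h := g) hf u l
    simp only [Pi.sub_apply, Pi.smul_apply] at ih ⊢
    rw [h1, ih, Nat.add_comm k k', h2, Nat.mul_comm k' k, Nat.add_comm k' k]
    rcases neg_one_pow_eq_or K k with h | h <;> rcases neg_one_pow_eq_or K k' with h' | h' <;>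
      rcases neg_one_pow_eq_or K (k * k') with h'' | h'' <;> simp only [pow_add, h, h', h''] <;> module

end ListCochains

theorem getElem_append_cons_eq_update {m : ℕ} {V : Type*} (a : List V) (x : V) (b : List V)
    (h : (a ++ x :: b).length = m) (ha : a.length < m) (z : V) :
    (fun i : Fin m => (a ++ z :: b)[(i : ℕ)]'(by simp at h ⊢; omega)) =
      Function.update (fun i : Fin m => (a ++ x :: b)[(i : ℕ)]) ⟨a.length, ha⟩ z := by
  funext i
  by_cases hi : i = ⟨a.length, ha⟩
  · subst hi; simp
  · rw [Function.update_of_ne hi]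
    simp only [Fin.ext_iff] at hi
    simp only [List.getElem_append, List.getElem_cons]
    split_ifs <;> first | rfl | omega

/-! ### Translation of multilinear cochains into functions on lists -/

section CochainToList

variable {K : Type*} [Field K]
  {V W X Y : Type*} [AddCommGroup V] [Module K V] [AddCommGroup W] [Module K W]
  [AddCommGroup X] [Module K X] [AddCommGroup Y] [Module K Y]

/-- A cochain as a function on lists, extended by zero to lists of the wrong length. -/
def toList (K V W : Type*) [Field K] [AddCommGroup V] [Module K V]
    [AddCommGroup W] [Module K W] (m : ℕ) : Cochain K V W m →ₗ[K] (List V → W) where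
  toFun f l := if h : l.length = m then f fun i => l[(i : ℕ)] else 0
  map_add' f g := by ext l; by_cases h : l.length = m <;> simp [h]
  map_smul' c f := by ext l; by_cases h : l.length = m <;> simp [h]

theorem toList_apply {m : ℕ} (f : Cochain K V W m) (l : List V) (h : l.length = m) :
    toList K V W m f l = f fun i => l[(i : ℕ)] := dif_pos h

theorem hasArity_toList {m : ℕ} (f : Cochain K V W m) : HasArity m (toList K V W m f) :=
  fun _ h => dif_neg h

theorem toList_ofFn {m : ℕ} (f : Cochain K V W m) (u : Fin m → V) :
    toList K V W m f (List.ofFn u) = f u := by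
  rw [toList_apply f _ (by simp)]
  simp

theorem listMultilinear_toList {m : ℕ} (f : Cochain K V W m) :
    ListMultilinear K (toList K V W m f) := by
  constructor
  · intro a x y b
    by_cases h : (a ++ x :: b).length = m
    · have ha : a.length < m := by simp at h; omega
      rw [toList_apply f _ (by simpa using h), toList_apply f _ h,
        toList_apply f _ (by simpa using h), getElem_append_cons_eq_update a x b h ha,
        getElem_append_cons_eq_update a x b h ha y, f.map_update_add,
        ← getElem_append_cons_eq_update a x b h ha x]
    · simp only [List.length_append, List.length_cons] at h
      rw [hasArity_toList f _ (by simpa using h), hasArity_toList f _ (by simpa using h),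
        hasArity_toList f _ (by simpa using h), add_zero]
  · intro a c x b
    by_cases h : (a ++ x :: b).length = m
    · have ha : a.length < m := by simp at h; omega
      rw [toList_apply f _ (by simpa using h), toList_apply f _ h,
        getElem_append_cons_eq_update a x b h ha, f.map_update_smul,
        ← getElem_append_cons_eq_update a x b h ha x]
    · simp only [List.length_append, List.length_cons] at h
      rw [hasArity_toList f _ (by simpa using h), hasArity_toList f _ (by simpa using h), smul_zero]

theorem toList_pairing (b : W →ₗ[K] X →ₗ[K] Y) {m n N : ℕ} (h : N = m + n)
    (f : Cochain K V W m) (g : Cochain K V X n) :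
    toList K V Y N (pairing b h f g) = listCup b m (toList K V W m f) (toList K V X n g) := by
  ext l
  rw [listCup_apply]
  by_cases hl : l.length = N
  · rw [toList_apply _ _ hl, toList_apply f _ (by simp; omega), toList_apply g _ (by simp; omega)]
    simp [pairing]
  · rw [hasArity_toList _ _ hl]
    by_cases hm : m ≤ l.length
    · rw [hasArity_toList g _ (by simp; omega), map_zero]
    · rw [hasArity_toList f _ (by simp; omega), map_zero, LinearMap.zero_apply]

theorem ListMultilinear.map_zero {f : List V → W} (hf : ListMultilinear K f) (a b : List V) :
    f (a ++ 0 :: b) = 0 := by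
  simpa using hf.map_smul a 0 0 b

theorem toList_insertAt {m k N : ℕ} (h : N = m + k) (i : Fin m)
    (f : Cochain K V W m) (g : Cochain K V V (k + 1)) (l : List V) :
    toList K V W N (insertAt h i f g) l =
      toList K V W m f (l.take i ++ toList K V V (k + 1) g ((l.drop i).take (k + 1)) ::
        l.drop (i + k + 1)) := by
  by_cases hl : l.length = N
  · rw [toList_apply _ _ hl, toList_apply g _ (by simp; omega), toList_apply f _ (by simp; omega)]
    change f _ = _
    congr 1
    funext j
    simp only [insertArgs, Function.update_apply, Fin.ext_iff, Fin.lt_def, List.getElem_append,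
      List.getElem_cons, List.length_take, List.getElem_take, List.getElem_drop]
    split_ifs <;> first | rfl | omega | (congr 1; omega)
  · rw [hasArity_toList _ _ hl]
    -- On a list of the wrong length either the outer list has the wrong length too, or the slice
    -- given to `g` is too short. In the second case `g` contributes a zero entry, which the
    -- multilinear `f` annihilates.
    by_cases hg : ((l.drop i).take (k + 1)).length = k + 1
    · rw [hasArity_toList f]
      simp at hg ⊢
      omega
    · rw [hasArity_toList g _ hg, (listMultilinear_toList f).map_zero]

theorem listCirc_eq_sum (k : ℕ) {g : List V → V} (hg : g [] = 0) {m : ℕ} {f : List V → W}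
    (hf : HasArity m f) (hf' : ListMultilinear K f) (l : List V) :
    listCirc (K := K) k g f l = ∑ i ∈ Finset.range m, (-1 : K) ^ (i * k) •
      f (l.take i ++ g ((l.drop i).take (k + 1)) :: l.drop (i + k + 1)) := by
  induction l generalizing m f with
  | nil =>
    -- On the empty list the sum still has `m` terms, each equal to `f [g []] = f [0]`; they vanish
    -- by multilinearity.
    have := hf'.map_zero [] []
    simp only [List.nil_append] at this
    simp [listCirc_nil, hg, this]
  | cons u l ih =>
    cases m with
    | zero => simp [listCirc_of_hasArity_zero k g hf]
    | succ m =>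
      rw [Finset.sum_range_succ', listCirc_cons, ih (hf.cons u) (hf'.cons u), add_comm,
        Finset.smul_sum]
      congr 1
      · refine Finset.sum_congr rfl fun i _ => ?_
        rw [smul_smul, ← pow_add, show k + i * k = (i + 1) * k by ring,
          show i + 1 + k + 1 = (i + k + 1) + 1 by omega]
        rfl
      · simp

theorem toList_sum_insertAt {m k N : ℕ} (h : N = m + k)
    (f : Cochain K V W m) (g : Cochain K V V (k + 1)) :
    toList K V W N (∑ i : Fin m, (-1 : K) ^ ((i : ℕ) * k) • insertAt h i f g) =
      listCirc (K := K) k (toList K V V (k + 1) g) (toList K V W m f) := by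
  ext l
  rw [listCirc_eq_sum k (hasArity_toList g _ (by simp)) (hasArity_toList f)
    (listMultilinear_toList f), ← Fin.sum_univ_eq_sum_range (fun i => (-1 : K) ^ (i * k) •
      toList K V W m f (l.take i ++ toList K V V (k + 1) g ((l.drop i).take (k + 1)) ::
        l.drop (i + k + 1)))]
  simp only [map_sum, map_smul, Finset.sum_apply, Pi.smul_apply, toList_insertAt]

/-- Linearity in the inserted function uses linearity of `f` in each entry. It is what allows a
graded commutator to be inserted term by term. -/
theorem listCirc_smul_add_smul_right (k : ℕ) {f : List V → W} (hf : ListMultilinear K f)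
    (g h : List V → V) (c c' : K) :
    listCirc (K := K) k (c • g + c' • h) f =
      c • listCirc (K := K) k g f + c' • listCirc (K := K) k h f := by
  ext l
  induction l generalizing f with
  | nil => simp [listCirc_nil]
  | cons u l ih =>
    have h1 : ∀ (x y : V) (b : List V),
        f ((c • x + c' • y) :: b) = c • f (x :: b) + c' • f (y :: b) := fun x y b => by
      have h1 := hf.map_add [] (c • x) (c' • y) b
      have h2 := hf.map_smul [] c x b
      have h3 := hf.map_smul [] c' y b
      simp only [List.nil_append] at h1 h2 h3
      rw [h1, h2, h3]
    have := ih (hf.cons u)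
    simp only [Pi.add_apply, Pi.smul_apply] at this ⊢
    simp only [listCirc_cons, Pi.add_apply, Pi.smul_apply, h1, this]
    module

theorem listCirc_idCochain (k : ℕ) {g : List V → V} (hg : HasArity (k + 1) g) :
    listCirc (K := K) k g (toList K V V 1 (idCochain K V)) = g := by
  ext l
  cases l with
  | nil => rw [listCirc_nil, hg _ (by simp)]
  | cons u l =>
    rw [listCirc_cons, listCirc_of_hasArity_zero k g ((hasArity_toList _).cons u)]
    simp only [Pi.zero_apply, smul_zero, add_zero]
    by_cases h : l.length ≤ k
    · rw [toList_apply _ _ (by simp; omega), List.take_of_length_le h]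
      rfl
    · rw [hasArity_toList _ _ (by simp; omega), hg _ (by simp; omega)]

end CochainToList

/-! ### The bicrossed product and the commutator with the inclusion of `A'` -/

namespace MatchedPair

variable {K A A' : Type*} [Field K]
  [NonUnitalRing A] [Module K A] [IsScalarTower K A A] [SMulCommClass K A A]
  [NonUnitalRing A'] [Module K A'] [IsScalarTower K A' A'] [SMulCommClass K A' A']

/-- The product of the bicrossed product `A ⋈ A'`. -/
def bicrossedMul (P : MatchedPair K A A') : A × A' →ₗ[K] A × A' →ₗ[K] A × A' :=
  LinearMap.mk₂ K
    (fun a b => (a.1 * b.1 + P.ξ b.2 a.1 + P.η a.2 b.1, a.2 * b.2 + P.ρ a.1 b.2 + P.μ b.1 a.2))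
    (fun a a' b => by ext <;> simp [add_mul] <;> abel)
    (fun c a b => by ext <;> simp [smul_mul_assoc])
    (fun a b b' => by ext <;> simp [mul_add] <;> abel)
    (fun c a b => by ext <;> simp [mul_smul_comm])

theorem bicrossedMul_apply (P : MatchedPair K A A') (a b : A × A') : P.bicrossedMul a b =
    (a.1 * b.1 + P.ξ b.2 a.1 + P.η a.2 b.1, a.2 * b.2 + P.ρ a.1 b.2 + P.μ b.1 a.2) := rfl

theorem bicrossedMul_assoc (P : MatchedPair K A A') (a b c : A × A') :
    P.bicrossedMul (P.bicrossedMul a b) c = P.bicrossedMul a (P.bicrossedMul b c) := by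
  -- The two mixed axioms are oriented to eliminate the terms `ρ (η u x) v` and `η (ρ x u) y`; the
  -- other axioms already serve as rewriting rules from left to right.
  have h1 := eq_sub_of_add_eq (P.mid b.1 a.2 c.2)
  have h2 := eq_sub_of_add_eq (P.mid' b.2 a.1 c.1)
  have h3 := LinearMap.congr_fun (P.rep.left_right a.1 c.1) b.2
  have h4 := LinearMap.congr_fun (P.rep'.left_right a.2 c.2) b.1
  simp only [LinearMap.comp_apply] at h3 h4
  simp only [bicrossedMul_apply, map_add, LinearMap.add_apply, mul_add, add_mul, P.ρ_mul, P.μ_mul,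
    P.η_mul, P.ξ_mul, P.rep.left_mul, P.rep.right_mul, P.rep'.left_mul, P.rep'.right_mul,
    LinearMap.comp_apply, h1, h2, h3, h4, mul_assoc]
  ext <;> simp only <;> abel

/-- The product of functions on lists with values in `A ⋈ A'`. -/
def cup (P : MatchedPair K A A') (m : ℕ) :
    (List A' → A × A') →ₗ[K] (List A' → A × A') →ₗ[K] (List A' → A × A') :=
  listCup P.bicrossedMul m

theorem cup_assoc (P : MatchedPair K A A') (m n N : ℕ) (hN : N = m + n)
    (f g h : List A' → A × A') :
    P.cup N (P.cup m f g) h = P.cup m f (P.cup n g h) :=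
  hN ▸ listCup_assoc _ P.bicrossedMul_assoc m n f g h

variable (K A A')

/-- Functions with values in `A` as functions with values in `A ⋈ A'`. -/
def left : (List A' → A) →ₗ[K] (List A' → A × A') := (LinearMap.inl K A A').compLeft _

/-- Functions with values in `A'` as functions with values in `A ⋈ A'`. -/
def right : (List A' → A') →ₗ[K] (List A' → A × A') := (LinearMap.inr K A A').compLeft _

/-- The component in `A` of a function with values in `A ⋈ A'`. -/
def projLeft : (List A' → A × A') →ₗ[K] (List A' → A) := (LinearMap.fst K A A').compLeft _

/-- The component in `A'` of a function with values in `A ⋈ A'`. -/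
def projRight : (List A' → A × A') →ₗ[K] (List A' → A') := (LinearMap.snd K A A').compLeft _

/-- The inclusion of `A'` as a function on lists with values in `A ⋈ A'`. -/
def incl : List A' → A × A' := right K A A' (toList K A' A' 1 (idCochain K A'))

/-- The product of `A'` as a function on lists. -/
def mulList : List A' → A' :=
  toList K A' A' 2 (pairing (LinearMap.mul K A') rfl (idCochain K A') (idCochain K A'))

variable {K A A'}

theorem projLeft_left (f : List A' → A) : projLeft K A A' (left K A A' f) = f := rfl

theorem projLeft_right (g : List A' → A') : projLeft K A A' (right K A A' g) = 0 := rfl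

theorem projRight_left (f : List A' → A) : projRight K A A' (left K A A' f) = 0 := rfl

theorem projRight_right (g : List A' → A') : projRight K A A' (right K A A' g) = g := rfl

theorem left_projLeft_add_right_projRight (f : List A' → A × A') :
    left K A A' (projLeft K A A' f) + right K A A' (projRight K A A' f) = f := by
  ext l <;> simp [left, right, projLeft, projRight]

theorem cup_left_left (P : MatchedPair K A A') (m : ℕ) (f g : List A' → A) :
    P.cup m (left K A A' f) (left K A A' g) = left K A A' (listCup (LinearMap.mul K A) m f g) := by
  ext l <;> simp [cup, left, listCup_apply, bicrossedMul_apply]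

theorem cup_right_right (P : MatchedPair K A A') (m : ℕ) (f g : List A' → A') :
    P.cup m (right K A A' f) (right K A A' g) =
      right K A A' (listCup (LinearMap.mul K A') m f g) := by
  ext l <;> simp [cup, right, listCup_apply, bicrossedMul_apply]

theorem hasArity_left {m : ℕ} {f : List A' → A} (hf : HasArity m f) :
    HasArity m (left K A A' f) := fun l hl => by simp [left, hf l hl]

theorem hasArity_incl : HasArity 1 (incl K A A') := fun l hl => by
  simp [incl, right, hasArity_toList _ l hl]

theorem listCirc_left (k : ℕ) (g : List A' → A') (f : List A' → A) :
    listCirc (K := K) k g (left K A A' f) = left K A A' (listCirc (K := K) k g f) :=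
  listCirc_compLeft _ _ _ _

theorem listCirc_right (k : ℕ) (g : List A' → A') (f : List A' → A') :
    listCirc (K := K) k g (right K A A' f) = right K A A' (listCirc (K := K) k g f) :=
  listCirc_compLeft _ _ _ _

theorem listCirc_incl (k : ℕ) {g : List A' → A'} (hg : HasArity (k + 1) g) :
    listCirc (K := K) k g (incl K A A') = right K A A' g := by
  rw [incl, listCirc_right, listCirc_idCochain k hg]

theorem hasArity_mulList : HasArity 2 (mulList K A') := hasArity_toList _

theorem right_mulList (P : MatchedPair K A A') :
    right K A A' (mulList K A') = P.cup 1 (incl K A A') (incl K A A') := by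
  rw [incl, cup_right_right, mulList, toList_pairing]

/-- The graded commutator with the inclusion of `A'` in `A ⋈ A'`. -/
def ad (P : MatchedPair K A A') (m : ℕ) : (List A' → A) →ₗ[K] (List A' → A × A') :=
  ((P.cup m).flip (incl K A A') - (-1 : K) ^ m • P.cup 1 (incl K A A')) ∘ₗ left K A A'

theorem ad_apply (P : MatchedPair K A A') (m : ℕ) (f : List A' → A) :
    P.ad m f = P.cup m (left K A A' f) (incl K A A') -
      (-1 : K) ^ m • P.cup 1 (incl K A A') (left K A A' f) := rfl

/-- The component of `ad` with values in `A`. -/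
def adLeft (P : MatchedPair K A A') (m : ℕ) : (List A' → A) →ₗ[K] (List A' → A) :=
  projLeft K A A' ∘ₗ P.ad m

/-- The component of `ad` with values in `A'`. -/
def adRight (P : MatchedPair K A A') (m : ℕ) : (List A' → A) →ₗ[K] (List A' → A') :=
  projRight K A A' ∘ₗ P.ad m

theorem left_adLeft_add_right_adRight (P : MatchedPair K A A') (m : ℕ) (f : List A' → A) :
    left K A A' (P.adLeft m f) + right K A A' (P.adRight m f) = P.ad m f :=
  left_projLeft_add_right_projRight _

/-- A commutator in an associative graded algebra is a graded derivation: the two terms with the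
inclusion in the middle cancel. -/
theorem ad_mul (P : MatchedPair K A A') (m n : ℕ) (f g : List A' → A) :
    P.ad (m + n) (listCup (LinearMap.mul K A) m f g) =
      P.cup m (left K A A' f) (P.ad n g) +
        (-1 : K) ^ n • P.cup (m + 1) (P.ad m f) (left K A A' g) := by
  simp only [ad_apply, ← cup_left_left P, map_sub, map_smul, LinearMap.sub_apply,
    LinearMap.smul_apply, P.cup_assoc m n _ rfl, P.cup_assoc m 1 _ rfl,
    P.cup_assoc 1 m _ (Nat.add_comm m 1), pow_add]
  module

/-- The derivation rule is applied to both products in `ad`. Inserting `g` into the inclusion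
returns `g`, which produces the two correction terms. -/
theorem listCirc_ad (P : MatchedPair K A A') (m k : ℕ) {f : List A' → A} (hf : HasArity m f)
    {g : List A' → A'} (hg : HasArity (k + 1) g) :
    listCirc (K := K) k g (P.ad m f) = P.ad (m + k) (listCirc (K := K) k g f) +
      (-1 : K) ^ (m * k) • P.cup m (left K A A' f) (right K A A' g) -
      (-1 : K) ^ m • P.cup (k + 1) (right K A A' g) (left K A A' f) := by
  have h1 := listCirc_cup P.bicrossedMul k m g (hasArity_left (K := K) hf) (incl K A A')
  have h2 := listCirc_cup P.bicrossedMul k 1 g (hasArity_incl (K := K)) (left K A A' f)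
  change listCirc k g (P.cup _ _ _) = P.cup _ _ _ + _ • P.cup _ _ _ at h1 h2
  simp only [ad_apply, map_sub, map_smul, h1, h2, listCirc_left, listCirc_incl k hg,
    Nat.add_comm 1 k, pow_add, one_mul]
  module

/-- The inclusion `i` has odd degree, so the double commutator with `i` is the commutator with `i²`,
and `i²` is the product of `A'`. -/
theorem cup_ad_incl (P : MatchedPair K A A') (m : ℕ) (f : List A' → A) :
    P.cup (m + 1) (P.ad m f) (incl K A A') + (-1 : K) ^ m • P.cup 1 (incl K A A') (P.ad m f) =
      P.cup m (left K A A' f) (right K A A' (mulList K A')) -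
        P.cup 2 (right K A A' (mulList K A')) (left K A A' f) := by
  simp only [ad_apply, right_mulList P, map_sub, map_smul, LinearMap.sub_apply,
    LinearMap.smul_apply, P.cup_assoc m 1 _ rfl, P.cup_assoc 1 m _ (Nat.add_comm m 1),
    P.cup_assoc 1 1 2 rfl]
  rcases neg_one_pow_eq_or K m with h | h <;> rw [h] <;> module

/-- The derivation rule applied to the square of the inclusion. -/
theorem listCirc_mulList (P : MatchedPair K A A') (k : ℕ) {g : List A' → A'}
    (hg : HasArity (k + 1) g) :
    right K A A' (listCirc (K := K) k g (mulList K A')) =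
      P.cup (k + 1) (right K A A' g) (incl K A A') +
        (-1 : K) ^ k • P.cup 1 (incl K A A') (right K A A' g) := by
  have h := listCirc_cup P.bicrossedMul k 1 g (hasArity_incl (K := K)) (incl K A A')
  change listCirc k g (P.cup _ _ _) = P.cup _ _ _ + _ • P.cup _ _ _ at h
  rw [← listCirc_right, right_mulList P, h, listCirc_incl k hg, Nat.add_comm 1 k, one_mul]

theorem adRight_toList (P : MatchedPair K A A') (m : ℕ) (f : Cochain K A' A m) :
    P.adRight m (toList K A' A m f) =
      toList K A' A' (m + 1) (P.rhoCochain f - (-1 : K) ^ m • P.muCochain f) := by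
  rw [map_sub, map_smul, rhoCochain, muCochain, toList_pairing, toList_pairing]
  ext l
  simp [adRight, projRight, ad_apply, cup, left, right, incl, listCup_apply, bicrossedMul_apply]

theorem adLeft_toList (P : MatchedPair K A A') (m : ℕ) (f : Cochain K A' A m) :
    P.adLeft m (toList K A' A m f) =
      toList K A' A (m + 1) (pairing P.ξ.flip rfl f (idCochain K A') -
        (-1 : K) ^ m • pairing P.η (Nat.add_comm m 1) (idCochain K A') f) := by
  rw [map_sub, map_smul, toList_pairing, toList_pairing]
  ext l
  simp [adLeft, projLeft, ad_apply, cup, left, right, incl, listCup_apply, bicrossedMul_apply]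

theorem hasArity_adRight (P : MatchedPair K A A') {m : ℕ} (f : Cochain K A' A m) :
    HasArity (m + 1) (P.adRight m (toList K A' A m f)) := by
  rw [adRight_toList]
  exact hasArity_toList _

/-- In the double commutator of `cup_ad_incl`, the inner one splits into its components in `A` and
`A'`. By `listCirc_mulList` the `A'`-part contributes an insertion into the product. -/
theorem ad_adLeft (P : MatchedPair K A A') (m : ℕ) (f : Cochain K A' A m) :
    P.ad (m + 1) (P.adLeft m (toList K A' A m f)) =
      P.cup m (left K A A' (toList K A' A m f)) (right K A A' (mulList K A')) -
        P.cup 2 (right K A A' (mulList K A')) (left K A A' (toList K A' A m f)) -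
        right K A A' (listCirc (K := K) m (P.adRight m (toList K A' A m f)) (mulList K A')) := by
  rw [← cup_ad_incl, listCirc_mulList P m (P.hasArity_adRight f), ad_apply,
    ← left_adLeft_add_right_adRight]
  simp only [map_add, LinearMap.add_apply, pow_succ]
  module

/-! ### The bracket and the differential in terms of cup products and insertions -/

/-- The bracket on functions on lists. -/
def listBracket (P : MatchedPair K A A') (m n : ℕ) (f g : List A' → A) : List A' → A :=
  listCup (LinearMap.mul K A) n g f - (-1 : K) ^ (m * n) • listCup (LinearMap.mul K A) m f g -
    listCirc (K := K) n (P.adRight n g) f +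
    (-1 : K) ^ (m * n) • listCirc (K := K) m (P.adRight m f) g

/-- The differential on functions on lists. -/
def listDifferential (P : MatchedPair K A A') (m : ℕ) (f : List A' → A) : List A' → A :=
  P.adLeft m f + (-1 : K) ^ m • listCirc (K := K) 1 (mulList K A') f

theorem insertAt_sub_smul_right {V W : Type*} [AddCommGroup V] [Module K V] [AddCommGroup W]
    [Module K W] {m k N : ℕ} (h : N = m + k) (i : Fin m)
    (f : Cochain K V W m) (g g' : Cochain K V V (k + 1)) (c : K) :
    insertAt h i f (g - c • g') = insertAt h i f g - c • insertAt h i f g' := by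
  rw [sub_eq_add_neg, ← neg_smul, insertAt_add_right, insertAt_smul_right, neg_smul,
    ← sub_eq_add_neg]

theorem toList_bracket (P : MatchedPair K A A') {m n N : ℕ} (h : N = m + n)
    (f : Cochain K A' A m) (g : Cochain K A' A n) :
    toList K A' A N (P.bracket h f g) =
      P.listBracket m n (toList K A' A m f) (toList K A' A n g) := by
  have h1 := toList_sum_insertAt h f (P.rhoCochain g - (-1 : K) ^ n • P.muCochain g)
  have h2 := toList_sum_insertAt (h.trans (Nat.add_comm m n)) g
    (P.rhoCochain f - (-1 : K) ^ m • P.muCochain f)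
  rw [listBracket, adRight_toList, adRight_toList, ← h1, ← h2, ← toList_pairing _ h,
    ← toList_pairing _ (h.trans (Nat.add_comm m n)), ← map_smul, ← map_smul, ← map_sub, ← map_sub,
    ← map_add]
  congr 1
  simp only [bracket, insertAt_sub_smul_right, smul_sub, Finset.sum_sub_distrib, Finset.smul_sum,
    smul_smul, Nat.mul_add, mul_one, pow_add, mul_assoc, mul_comm,
    mul_left_comm]
  abel

theorem toList_differential (P : MatchedPair K A A') {n : ℕ} (f : Cochain K A' A (n + 1)) :
    toList K A' A (n + 2) (P.differential f) =
      P.listDifferential (n + 1) (toList K A' A (n + 1) f) := by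
  have h1 := toList_sum_insertAt (k := 1) rfl f
    (pairing (LinearMap.mul K A') rfl (idCochain K A') (idCochain K A'))
  rw [listDifferential, adLeft_toList, mulList, ← h1, ← map_smul, ← map_add]
  congr 1
  simp only [differential, pow_succ, mul_one, mul_neg, neg_smul, Finset.sum_neg_distrib]
  module

/-- Separates the products of two `A`-valued functions from the mixed products. The mixed products
are the ones that cancel against the corrections in `listCirc_ad`. -/
theorem ad_mul_eq_left_add (P : MatchedPair K A A') (m n : ℕ) (f g : List A' → A) :
    P.ad (m + n) (listCup (LinearMap.mul K A) m f g) =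
      left K A A' (listCup (LinearMap.mul K A) m f (P.adLeft n g) +
        (-1 : K) ^ n • listCup (LinearMap.mul K A) (m + 1) (P.adLeft m f) g) +
      (P.cup m (left K A A' f) (right K A A' (P.adRight n g)) +
        (-1 : K) ^ n • P.cup (m + 1) (right K A A' (P.adRight m f)) (left K A A' g)) := by
  rw [ad_mul, ← left_adLeft_add_right_adRight, ← left_adLeft_add_right_adRight]
  simp only [map_add, map_smul, LinearMap.add_apply, cup_left_left]
  module

theorem adLeft_mul (P : MatchedPair K A A') (m n : ℕ) (f g : List A' → A) :
    P.adLeft (m + n) (listCup (LinearMap.mul K A) m f g) =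
      listCup (LinearMap.mul K A) m f (P.adLeft n g) +
        (-1 : K) ^ n • listCup (LinearMap.mul K A) (m + 1) (P.adLeft m f) g +
      (projLeft K A A' (P.cup m (left K A A' f) (right K A A' (P.adRight n g))) +
        (-1 : K) ^ n •
          projLeft K A A' (P.cup (m + 1) (right K A A' (P.adRight m f)) (left K A A' g))) := by
  rw [adLeft, LinearMap.comp_apply, ad_mul_eq_left_add, map_add, projLeft_left]
  simp only [map_add, map_smul, adLeft, LinearMap.comp_apply]

theorem adRight_mul (P : MatchedPair K A A') (m n : ℕ) (f g : List A' → A) :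
    P.adRight (m + n) (listCup (LinearMap.mul K A) m f g) =
      projRight K A A' (P.cup m (left K A A' f) (right K A A' (P.adRight n g))) +
        (-1 : K) ^ n •
          projRight K A A' (P.cup (m + 1) (right K A A' (P.adRight m f)) (left K A A' g)) := by
  rw [adRight, LinearMap.comp_apply, ad_mul_eq_left_add, map_add, projRight_left, zero_add]
  simp only [map_add, map_smul, adRight, LinearMap.comp_apply]

theorem adLeft_listCirc (P : MatchedPair K A A') (m k : ℕ) {f : List A' → A} (hf : HasArity m f)
    {g : List A' → A'} (hg : HasArity (k + 1) g) :
    P.adLeft (m + k) (listCirc (K := K) k g f) = listCirc (K := K) k g (P.adLeft m f) -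
      (-1 : K) ^ (m * k) • projLeft K A A' (P.cup m (left K A A' f) (right K A A' g)) +
      (-1 : K) ^ m • projLeft K A A' (P.cup (k + 1) (right K A A' g) (left K A A' f)) := by
  have h := congrArg (projLeft K A A') (P.listCirc_ad m k hf hg)
  rw [projLeft, ← listCirc_compLeft, ← projLeft, map_sub, map_add, map_smul, map_smul] at h
  simp only [adLeft, LinearMap.comp_apply, h]
  abel

theorem adRight_listCirc (P : MatchedPair K A A') (m k : ℕ) {f : List A' → A} (hf : HasArity m f)
    {g : List A' → A'} (hg : HasArity (k + 1) g) :
    P.adRight (m + k) (listCirc (K := K) k g f) = listCirc (K := K) k g (P.adRight m f) -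
      (-1 : K) ^ (m * k) • projRight K A A' (P.cup m (left K A A' f) (right K A A' g)) +
      (-1 : K) ^ m • projRight K A A' (P.cup (k + 1) (right K A A' g) (left K A A' f)) := by
  have h := congrArg (projRight K A A') (P.listCirc_ad m k hf hg)
  rw [projRight, ← listCirc_compLeft, ← projRight, map_sub, map_add, map_smul, map_smul] at h
  simp only [adRight, LinearMap.comp_apply, h]
  abel

variable {m n r : ℕ} (P : MatchedPair K A A') (f : Cochain K A' A m) (g : Cochain K A' A n)
  (h : Cochain K A' A r)

theorem adLeft_adLeft :
    P.adLeft (m + 1) (P.adLeft m (toList K A' A m f)) =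
      projLeft K A A' (P.cup m (left K A A' (toList K A' A m f)) (right K A A' (mulList K A'))) -
        projLeft K A A'
          (P.cup 2 (right K A A' (mulList K A')) (left K A A' (toList K A' A m f))) := by
  have := congrArg (projLeft K A A') (P.ad_adLeft m f)
  rwa [map_sub, map_sub, projLeft_right, sub_zero] at this

theorem adRight_adLeft :
    P.adRight (m + 1) (P.adLeft m (toList K A' A m f)) =
      projRight K A A' (P.cup m (left K A A' (toList K A' A m f)) (right K A A' (mulList K A'))) -
        projRight K A A'
          (P.cup 2 (right K A A' (mulList K A')) (left K A A' (toList K A' A m f))) -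
        listCirc (K := K) m (P.adRight m (toList K A' A m f)) (mulList K A') := by
  have := congrArg (projRight K A A') (P.ad_adLeft m f)
  rwa [map_sub, map_sub, projRight_right] at this

/-- `adRight` is an anti-morphism of graded Lie algebras. -/
theorem adRight_listBracket :
    P.adRight (m + n) (P.listBracket m n (toList K A' A m f) (toList K A' A n g)) =
      (-1 : K) ^ (m * n) • listCirc (K := K) m (P.adRight m (toList K A' A m f))
          (P.adRight n (toList K A' A n g)) +
        (-1 : K) • listCirc (K := K) n (P.adRight n (toList K A' A n g))
          (P.adRight m (toList K A' A m f)) := by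
  have h1 := P.adRight_mul n m (toList K A' A n g) (toList K A' A m f)
  have h2 := P.adRight_listCirc n m (hasArity_toList g) (P.hasArity_adRight f)
  rw [Nat.add_comm n m] at h1 h2
  rw [listBracket, map_add, map_sub, map_sub, map_smul, map_smul, h1, h2, adRight_mul,
    P.adRight_listCirc m n (hasArity_toList f) (P.hasArity_adRight g), Nat.mul_comm n m]
  -- Each of the four mixed products arises once from a cup product and once, with the opposite
  -- sign, from an insertion.
  rcases neg_one_pow_eq_or K (m * n) with e | e <;> rw [e] <;> module

/-- The mixed products with the product of `A'` cancel between `adRight_adLeft` and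
`adRight_listCirc`. -/
theorem adRight_listDifferential :
    P.adRight (m + 1) (P.listDifferential m (toList K A' A m f)) =
      (-1 : K) ^ m • listCirc (K := K) 1 (mulList K A') (P.adRight m (toList K A' A m f)) +
        (-1 : K) • listCirc (K := K) m (P.adRight m (toList K A' A m f)) (mulList K A') := by
  rw [listDifferential, map_add, map_smul, adRight_adLeft,
    P.adRight_listCirc m 1 (hasArity_toList f) hasArity_mulList, mul_one]
  rcases neg_one_pow_eq_or K m with e | e <;> rw [e] <;> module

theorem listBracket_skew (f g : List A' → A) :
    P.listBracket m n f g = -((-1 : K) ^ (m * n) • P.listBracket n m g f) := by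
  rw [listBracket, listBracket, Nat.mul_comm n m]
  rcases neg_one_pow_eq_or K (m * n) with e | e <;> rw [e] <;> module

theorem listCirc_listCup_mul (k : ℕ) (g : List A' → A') {f : List A' → A} (hf : HasArity m f)
    (f' : List A' → A) :
    listCirc (K := K) k g (listCup (LinearMap.mul K A) m f f') =
      listCup (LinearMap.mul K A) (m + k) (listCirc (K := K) k g f) f' +
      (-1 : K) ^ (m * k) • listCup (LinearMap.mul K A) m f (listCirc (K := K) k g f') :=
  listCirc_cup _ _ _ _ hf _

theorem listCup_mul_assoc (m n N : ℕ) (hN : N = m + n) (f g h : List A' → A) :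
    listCup (LinearMap.mul K A) N (listCup (LinearMap.mul K A) m f g) h =
      listCup (LinearMap.mul K A) m f (listCup (LinearMap.mul K A) n g h) :=
  hN ▸ listCup_assoc _ (fun x y z => by simp [mul_assoc]) _ _ _ _ _

/-- The pre-Lie identity turns the commutator found in `adRight_listBracket` into a commutator of
insertion operators. -/
theorem listCirc_adRight_listBracket {W : Type*} [AddCommGroup W] [Module K W]
    {w : List A' → W} (hw : ListMultilinear K w) :
    listCirc (K := K) (m + n)
        (P.adRight (m + n) (P.listBracket m n (toList K A' A m f) (toList K A' A n g))) w =
      (-1 : K) ^ (m * n) • listCirc (K := K) m (P.adRight m (toList K A' A m f))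
        (listCirc (K := K) n (P.adRight n (toList K A' A n g)) w) -
      listCirc (K := K) n (P.adRight n (toList K A' A n g))
        (listCirc (K := K) m (P.adRight m (toList K A' A m f)) w) := by
  have h1 := listCirc_preLie m n (P.hasArity_adRight f) (P.hasArity_adRight g) hw
  rw [adRight_listBracket, listCirc_smul_add_smul_right _ hw, eq_add_of_sub_eq h1]
  module

theorem listCirc_adRight_listDifferential {W : Type*} [AddCommGroup W] [Module K W]
    {w : List A' → W} (hw : ListMultilinear K w) :
    listCirc (K := K) (m + 1) (P.adRight (m + 1) (P.listDifferential m (toList K A' A m f))) w =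
      (-1 : K) ^ m • listCirc (K := K) 1 (mulList K A')
        (listCirc (K := K) m (P.adRight m (toList K A' A m f)) w) -
      listCirc (K := K) m (P.adRight m (toList K A' A m f))
        (listCirc (K := K) 1 (mulList K A') w) := by
  have h1 := listCirc_preLie m 1 (P.hasArity_adRight f) (hasArity_mulList (K := K)) hw
  rw [adRight_listDifferential, listCirc_smul_add_smul_right _ hw, eq_add_of_sub_eq h1, mul_one]
  rcases neg_one_pow_eq_or K m with e | e <;> rw [e] <;> module

/-- With `i` the inclusion, this is `(i i) i - i (i i)`, so it expresses associativity. -/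
theorem listCirc_mulList_mulList (P : MatchedPair K A A') :
    listCirc (K := K) 1 (mulList K A') (mulList K A') = 0 := by
  have h := P.listCirc_mulList 1 (hasArity_mulList (K := K))
  rw [right_mulList P, P.cup_assoc 1 1 _ rfl, pow_one, neg_smul, one_smul, add_neg_cancel] at h
  simpa [projRight_right] using congrArg (projRight K A A') h

/-- Since the product has odd degree, the pre-Lie identity for it and itself says that the double
insertion equals its own negative; characteristic different from two then makes it vanish. -/
theorem listCirc_mulList_listCirc_mulList (P : MatchedPair K A A') (h2 : (2 : K) ≠ 0)
    {W : Type*} [AddCommGroup W] [Module K W] {w : List A' → W} (hw : ListMultilinear K w) :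
    listCirc (K := K) 1 (mulList K A') (listCirc (K := K) 1 (mulList K A') w) = 0 := by
  have h := listCirc_preLie 1 1 (hasArity_mulList (K := K)) (hasArity_mulList (K := K)) hw
  -- Zero coefficients in the linearity statement give that inserting the zero function yields zero.
  have h0 := listCirc_smul_add_smul_right 2 hw 0 0 (0 : K) 0
  simp only [zero_smul, add_zero] at h0
  rw [P.listCirc_mulList_mulList, h0, sub_zero, mul_one, pow_one, neg_smul, one_smul,
    eq_neg_iff_add_eq_zero, ← two_smul K] at h
  exact (smul_eq_zero.mp h).resolve_left h2

/-- The commutator with the product from `adLeft_adLeft` cancels the corrections in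
`adLeft_listCirc`, and the double insertion of the product is zero. -/
theorem listDifferential_listDifferential (h2 : (2 : K) ≠ 0) :
    P.listDifferential (m + 1) (P.listDifferential m (toList K A' A m f)) = 0 := by
  simp only [listDifferential, map_add, map_smul, adLeft_adLeft,
    P.adLeft_listCirc m 1 (hasArity_toList f) hasArity_mulList, mul_one, pow_succ,
    P.listCirc_mulList_listCirc_mulList h2 (listMultilinear_toList f)]
  rcases neg_one_pow_eq_or K m with e | e <;> rw [e] <;> module

/-- Both summands of the differential act on cup products by derivation rules. The mixed products in
`adLeft_mul` cancel those in `adLeft_listCirc`, and the double insertions match by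
`listCirc_adRight_listDifferential`. -/
theorem listDifferential_listBracket :
    P.listDifferential (m + n) (P.listBracket m n (toList K A' A m f) (toList K A' A n g)) =
      P.listBracket (m + 1) n (P.listDifferential m (toList K A' A m f)) (toList K A' A n g) +
      (-1 : K) ^ m • P.listBracket m (n + 1) (toList K A' A m f)
        (P.listDifferential n (toList K A' A n g)) := by
  have h1 := P.listCirc_adRight_listDifferential f (listMultilinear_toList g)
  have h2 := P.listCirc_adRight_listDifferential g (listMultilinear_toList f)
  have h3 := P.adLeft_mul n m (toList K A' A n g) (toList K A' A m f)
  have h4 := P.adLeft_listCirc n m (hasArity_toList g) (P.hasArity_adRight f)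
  rw [Nat.add_comm n m] at h3 h4
  rw [listBracket, listBracket, listBracket, h1, h2]
  simp only [listDifferential, map_add, map_sub, map_smul, LinearMap.add_apply,
    LinearMap.smul_apply, listCirc_listCup_mul _ _ (hasArity_toList f),
    listCirc_listCup_mul _ _ (hasArity_toList g), h3, h4, adLeft_mul,
    P.adLeft_listCirc m n (hasArity_toList f) (P.hasArity_adRight g), Nat.mul_add, Nat.add_mul,
    pow_add, mul_one, one_mul, Nat.mul_comm n m]
  rcases neg_one_pow_eq_or K (m * n) with e | e <;>
    rcases neg_one_pow_eq_or K m with e' | e' <;>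
    rcases neg_one_pow_eq_or K n with e'' | e'' <;>
    simp only [e, e', e''] <;> module

/-- Triple cup products cancel by associativity, products with one insertion by the derivation rule,
and double insertions by `listCirc_adRight_listBracket`. -/
theorem listBracket_jacobi :
    P.listBracket m (n + r) (toList K A' A m f)
        (P.listBracket n r (toList K A' A n g) (toList K A' A r h)) =
      P.listBracket (m + n) r (P.listBracket m n (toList K A' A m f) (toList K A' A n g))
        (toList K A' A r h) +
      (-1 : K) ^ (m * n) • P.listBracket n (m + r) (toList K A' A n g)
        (P.listBracket m r (toList K A' A m f) (toList K A' A r h)) := by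
  have h1 := P.listCirc_adRight_listBracket g h (listMultilinear_toList f)
  have h2 := P.listCirc_adRight_listBracket f h (listMultilinear_toList g)
  have h3 := P.listCirc_adRight_listBracket f g (listMultilinear_toList h)
  -- Only the outer brackets may be unfolded at first, so that the inner ones remain intact inside
  -- `adRight`, where `h1`, `h2` and `h3` apply.
  have unfold_bracket : ∀ (a b : ℕ) (x y : List A' → A), P.listBracket a b x y =
      listCup (LinearMap.mul K A) b y x - (-1 : K) ^ (a * b) • listCup (LinearMap.mul K A) a x y -
      listCirc (K := K) b (P.adRight b y) x +
      (-1 : K) ^ (a * b) • listCirc (K := K) a (P.adRight a x) y := fun _ _ _ _ => rfl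
  rw [unfold_bracket m (n + r), unfold_bracket (m + n) r, unfold_bracket n (m + r), h1, h2, h3]
  simp only [listBracket, map_add, map_sub, map_smul, LinearMap.add_apply, LinearMap.sub_apply,
    LinearMap.smul_apply, listCirc_listCup_mul _ _ (hasArity_toList f),
    listCirc_listCup_mul _ _ (hasArity_toList g), listCirc_listCup_mul _ _ (hasArity_toList h),
    listCup_mul_assoc m n (m + n) rfl, listCup_mul_assoc n m (m + n) (Nat.add_comm m n),
    listCup_mul_assoc m r (m + r) rfl, listCup_mul_assoc r m (m + r) (Nat.add_comm m r),
    listCup_mul_assoc n r (n + r) rfl, listCup_mul_assoc r n (n + r) (Nat.add_comm n r),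
    Nat.add_comm n m, Nat.add_comm r m, Nat.add_comm r n, Nat.mul_add, Nat.add_mul, pow_add,
    Nat.mul_comm n m, Nat.mul_comm r m, Nat.mul_comm r n]
  rcases neg_one_pow_eq_or K (m * n) with e | e <;>
    rcases neg_one_pow_eq_or K (m * r) with e' | e' <;>
    rcases neg_one_pow_eq_or K (n * r) with e'' | e'' <;>
    simp only [e, e', e''] <;> module

end MatchedPair

/-! ### The controlling algebra as a differential graded Lie algebra -/

namespace MatchedPair

variable {K A A' : Type*} [Field K]
  [NonUnitalRing A] [Module K A] [IsScalarTower K A A] [SMulCommClass K A A]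
  [NonUnitalRing A'] [Module K A'] [IsScalarTower K A' A'] [SMulCommClass K A' A']

variable (K A A') in
/-- The homogeneous elements of the control space. -/
abbrev homogeneous (n : ℕ) : Cochain K A' A (n + 1) →ₗ[K] ControlSpace K A A' :=
  DirectSum.lof K ℕ (fun n => Cochain K A' A (n + 1)) n

variable (K A A') in
/-- The elements of the control space as functions on lists. -/
def controlToList : ControlSpace K A A' →ₗ[K] (List A' → A) :=
  DirectSum.toModule K ℕ _ fun n => toList K A' A (n + 1)

theorem controlToList_homogeneous (n : ℕ) (f : Cochain K A' A (n + 1)) :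
    controlToList K A A' (homogeneous K A A' n f) = toList K A' A (n + 1) f :=
  DirectSum.toModule_lof (M := fun n => Cochain K A' A (n + 1)) K n f

theorem homogeneous_apply_of_ne {n k : ℕ} (h : k ≠ n) (f : Cochain K A' A (n + 1)) :
    homogeneous K A A' n f k = 0 :=
  DirectSum.of_eq_of_ne _ _ _ h

theorem homogeneous_apply_self (n : ℕ) (f : Cochain K A' A (n + 1)) :
    homogeneous K A A' n f n = f :=
  DirectSum.lof_apply (M := fun n => Cochain K A' A (n + 1)) K n f

theorem homogeneous_injective (n : ℕ) : Function.Injective (homogeneous K A A' n) :=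
  fun f g h => by rw [← homogeneous_apply_self n f, h, homogeneous_apply_self]

theorem controlToList_apply (x : ControlSpace K A A') (n : ℕ) (l : List A')
    (hl : l.length = n + 1) : controlToList K A A' x l = toList K A' A (n + 1) (x n) l := by
  induction x using DirectSum.induction_on with
  | zero => simp
  | of k f =>
    change controlToList K A A' (homogeneous K A A' k f) l =
      toList K A' A (n + 1) (homogeneous K A A' k f n) l
    rw [controlToList_homogeneous]
    by_cases h : n = k
    · subst h
      rw [homogeneous_apply_self]
    · rw [homogeneous_apply_of_ne h, hasArity_toList f l (by omega), map_zero, Pi.zero_apply]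
  | add x y hx hy => simp [hx, hy]

/-- Different summands are supported on lists of different lengths, so no component is lost.
Identities can therefore be checked on lists. -/
theorem controlToList_injective : Function.Injective (controlToList K A A') := by
  rw [injective_iff_map_eq_zero]
  intro x hx
  refine DFinsupp.ext fun n => ?_
  ext u
  have h := controlToList_apply x n (List.ofFn u) (by simp)
  rw [toList_ofFn, hx] at h
  exact h.symm

theorem homogeneous_mem (n : ℕ) (f : Cochain K A' A (n + 1)) (i : ℤ) (hi : i = n + 1) :
    homogeneous K A A' n f ∈ controlGrading K A A' i :=
  fun k hk => homogeneous_apply_of_ne (by omega) f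

theorem eq_zero_or_homogeneous_of_mem {i : ℤ} {x : ControlSpace K A A'}
    (hx : x ∈ controlGrading K A A' i) :
    x = 0 ∨ ∃ (n : ℕ) (f : Cochain K A' A (n + 1)), i = ((n + 1 : ℕ) : ℤ) ∧
      x = homogeneous K A A' n f := by
  by_cases hi : 1 ≤ i
  · obtain ⟨n, rfl⟩ : ∃ n : ℕ, i = ((n + 1 : ℕ) : ℤ) := ⟨(i - 1).toNat, by omega⟩
    refine Or.inr ⟨n, x n, rfl, DFinsupp.ext fun k => ?_⟩
    by_cases h : k = n
    · subst h
      exact (homogeneous_apply_self k (x k)).symm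
    · exact (hx k (by omega)).trans (homogeneous_apply_of_ne h _).symm
  · exact Or.inl (DFinsupp.ext fun k => hx k (by omega))

theorem isInternal_controlGrading : DirectSum.IsInternal (controlGrading K A A') := by
  classical
  constructor
  · intro y y' hy
    -- The shift by one: the `n`-th summand is seen only by the piece of degree `n + 1`.
    have key : ∀ (z : DirectSum ℤ fun i => controlGrading K A A' i) (n : ℕ),
        (DirectSum.coeAddMonoidHom (controlGrading K A A') z) n =
          (z ((n : ℤ) + 1) : ControlSpace K A A') n := by
      intro z n
      induction z using DirectSum.induction_on with
      | zero => simp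
      | of i x =>
        rw [DirectSum.coeAddMonoidHom_of]
        by_cases h : i = (n : ℤ) + 1
        · subst h
          rw [DirectSum.of_eq_same]
        · rw [DirectSum.of_eq_of_ne _ _ _ (Ne.symm h)]
          exact x.2 n (by omega)
      | add a b ha hb => simp [ha, hb]
    refine DFinsupp.ext fun i => Subtype.ext (DFinsupp.ext fun n => ?_)
    by_cases h : i = (n : ℤ) + 1
    · subst h
      rw [← key y n, ← key y' n, hy]
    · exact ((y i).2 n (by omega)).trans ((y' i).2 n (by omega)).symm
  · intro x
    induction x using DirectSum.induction_on with
    | zero => exact ⟨0, map_zero _⟩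
    | of n f =>
      exact ⟨DirectSum.of (fun i => controlGrading K A A' i) ((n : ℤ) + 1)
        ⟨homogeneous K A A' n f, homogeneous_mem n f _ rfl⟩, DirectSum.coeAddMonoidHom_of _ _ _⟩
    | add x y hx hy =>
      obtain ⟨a, rfl⟩ := hx
      obtain ⟨b, rfl⟩ := hy
      exact ⟨a + b, map_add _ _ _⟩

variable (P : MatchedPair K A A')

theorem controlBracket_homogeneous (p q : ℕ) (f : Cochain K A' A (p + 1))
    (g : Cochain K A' A (q + 1)) :
    P.controlBracket (homogeneous K A A' p f) (homogeneous K A A' q g) =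
      homogeneous K A A' (p + q + 1) (P.bracket (by omega) f g) := by
  simp only [controlBracket, homogeneous, DirectSum.toModule_lof, LinearMap.flip_apply,
    LinearMap.compr₂_apply]
  rfl

theorem controlDifferential_homogeneous (n : ℕ) (f : Cochain K A' A (n + 1)) :
    P.controlDifferential (homogeneous K A A' n f) =
      homogeneous K A A' (n + 1) (P.differential f) := by
  simp only [controlDifferential, homogeneous, DirectSum.toModule_lof]
  rfl

theorem isDGLieAlgebra_control (h2 : (2 : K) ≠ 0) :
    IsDGLieAlgebra (controlGrading K A A') P.controlBracket P.controlDifferential where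
  isInternal := isInternal_controlGrading
  bracket_mem i j x y hx hy := by
    obtain rfl | ⟨p, f, rfl, rfl⟩ := eq_zero_or_homogeneous_of_mem hx
    · simp
    obtain rfl | ⟨q, g, rfl, rfl⟩ := eq_zero_or_homogeneous_of_mem hy
    · simp
    rw [controlBracket_homogeneous]
    exact homogeneous_mem _ _ _ (by push_cast; ring)
  skew i j x y hx hy := by
    obtain rfl | ⟨p, f, rfl, rfl⟩ := eq_zero_or_homogeneous_of_mem hx
    · simp
    obtain rfl | ⟨q, g, rfl, rfl⟩ := eq_zero_or_homogeneous_of_mem hy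
    · simp
    apply controlToList_injective
    rw [← Nat.cast_mul, zpow_natCast]
    simp only [controlBracket_homogeneous, map_neg, map_smul, controlToList_homogeneous,
      toList_bracket]
    exact P.listBracket_skew _ _
  jacobi i j k x y z hx hy hz := by
    obtain rfl | ⟨p, f, rfl, rfl⟩ := eq_zero_or_homogeneous_of_mem hx
    · simp
    obtain rfl | ⟨q, g, rfl, rfl⟩ := eq_zero_or_homogeneous_of_mem hy
    · simp
    obtain rfl | ⟨r, h, rfl, rfl⟩ := eq_zero_or_homogeneous_of_mem hz
    · simp
    apply controlToList_injective
    rw [← Nat.cast_mul, zpow_natCast]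
    simp only [controlBracket_homogeneous, map_add, map_smul, controlToList_homogeneous,
      toList_bracket, show ∀ a b : ℕ, a + b + 1 + 1 = (a + 1) + (b + 1) by intros; omega]
    exact P.listBracket_jacobi f g h
  d_mem i x hx := by
    obtain rfl | ⟨p, f, rfl, rfl⟩ := eq_zero_or_homogeneous_of_mem hx
    · simp
    rw [controlDifferential_homogeneous]
    exact homogeneous_mem _ _ _ (by push_cast; ring)
  d_d x := by
    induction x using DirectSum.induction_on with
    | zero => simp
    | of n f =>
      change P.controlDifferential (P.controlDifferential (homogeneous K A A' n f)) = 0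
      apply controlToList_injective
      simp only [controlDifferential_homogeneous, controlToList_homogeneous, toList_differential,
        map_zero]
      exact P.listDifferential_listDifferential f h2
    | add x y hx hy => simp [hx, hy]
  leibniz i j x y hx hy := by
    obtain rfl | ⟨p, f, rfl, rfl⟩ := eq_zero_or_homogeneous_of_mem hx
    · simp
    obtain rfl | ⟨q, g, rfl, rfl⟩ := eq_zero_or_homogeneous_of_mem hy
    · simp
    apply controlToList_injective
    rw [zpow_natCast]
    simp only [controlBracket_homogeneous, controlDifferential_homogeneous, map_add, map_smul,
      controlToList_homogeneous, toList_bracket, toList_differential,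
      show p + q + 1 + 1 = (p + 1) + (q + 1) by omega]
    exact P.listDifferential_listBracket f g

theorem differential_add_bracket_apply (h2 : (2 : K) ≠ 0) (B : A' →ₗ[K] A) (u : Fin 2 → A') :
    (P.differential (n := 0) (MultilinearMap.ofSubsingleton K A' A (0 : Fin 1) B) +
      (2⁻¹ : K) • P.bracket (N := 2) (m₁ := 1) (m₂ := 1) rfl
        (MultilinearMap.ofSubsingleton K A' A (0 : Fin 1) B)
        (MultilinearMap.ofSubsingleton K A' A (0 : Fin 1) B)) u =
      B (u 0) * B (u 1) + P.ξ (u 1) (B (u 0)) + P.η (u 0) (B (u 1)) -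
        B (u 0 * u 1 + P.ρ (B (u 0)) (u 1) + P.μ (B (u 1)) (u 0)) := by
  -- For two equal arguments of degree one every term of the bracket occurs twice with the same
  -- sign, so the factor one half cancels. Here `x` is the product in `A`, `y` the `μ` term and `z`
  -- the `ρ` term.
  have h (x y z : A) : (2⁻¹ : K) • (x + x + -y - z + -z - y) = x - y - z := by
    rw [show x + x + -y - z + -z - y = (2 : K) • (x - y - z) by module, inv_smul_smul₀ h2]
  simp [differential, bracket, pairing, insertAt, insertArgs, rhoCochain, muCochain, idCochain, h]
  abel

end MatchedPair

theorem mainTheorem4 {K A A' : Type*} [Field K] (h2 : (2 : K) ≠ 0)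
    [NonUnitalRing A] [Module K A] [IsScalarTower K A A] [SMulCommClass K A A]
    [NonUnitalRing A'] [Module K A'] [IsScalarTower K A' A'] [SMulCommClass K A' A']
    (P : MatchedPair K A A') :
    IsDGLieAlgebra (MatchedPair.controlGrading K A A') P.controlBracket P.controlDifferential ∧
    Set.BijOn (fun B : A' →ₗ[K] A => MatchedPair.ofLinearMap B)
      {B | P.IsDeformationMap B}
      {x | IsMaurerCartan (MatchedPair.controlGrading K A A')
        P.controlBracket P.controlDifferential x} := by
  have key : ∀ B : A' →ₗ[K] A, P.controlDifferential (MatchedPair.ofLinearMap B) +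
      (2⁻¹ : K) • P.controlBracket (MatchedPair.ofLinearMap B) (MatchedPair.ofLinearMap B) = 0 ↔
      P.IsDeformationMap B := by
    intro B
    have h1 := P.controlDifferential_homogeneous 0
      (MultilinearMap.ofSubsingleton K A' A (0 : Fin 1) B)
    have h2' := P.controlBracket_homogeneous 0 0
      (MultilinearMap.ofSubsingleton K A' A (0 : Fin 1) B)
      (MultilinearMap.ofSubsingleton K A' A (0 : Fin 1) B)
    have h3 : P.controlDifferential (MatchedPair.ofLinearMap B) +
        (2⁻¹ : K) • P.controlBracket (MatchedPair.ofLinearMap B) (MatchedPair.ofLinearMap B) =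
        MatchedPair.homogeneous K A A' 1 _ :=
      (congrArg₂ (fun x y => x + (2⁻¹ : K) • y) h1 h2').trans
        ((congrArg _ (map_smul _ _ _).symm).trans (map_add _ _ _).symm)
    rw [h3, ← map_zero (MatchedPair.homogeneous K A A' 1),
      (MatchedPair.homogeneous_injective 1).eq_iff]
    constructor
    · intro h u v
      have := (P.differential_add_bracket_apply h2 B ![u, v]).symm.trans
        (congrArg (fun F : Cochain K A' A 2 => F ![u, v]) h)
      exact sub_eq_zero.mp this
    · intro h
      refine MultilinearMap.ext fun u => ?_
      exact (P.differential_add_bracket_apply h2 B u).trans (sub_eq_zero.mpr (h _ _))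
  refine ⟨P.isDGLieAlgebra_control h2, fun B hB => ?_, fun B _ B' _ h => ?_, fun x hx => ?_⟩
  · exact ⟨MatchedPair.homogeneous_mem 0 _ 1 (by norm_num), (key B).mpr hB⟩
  · have h' := MatchedPair.homogeneous_injective 0 h
    exact (MultilinearMap.ofSubsingleton K A' A (0 : Fin 1)).injective h'
  · obtain ⟨hx, hmc⟩ := hx
    -- An element of degree one is concentrated in the summand of index zero, whose cochains have
    -- one argument and are therefore linear maps.
    have hx' : x = MatchedPair.ofLinearMap
        ((MultilinearMap.ofSubsingleton K A' A (0 : Fin 1)).symm (x 0)) := by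
      refine DFinsupp.ext fun n => ?_
      rw [MatchedPair.ofLinearMap, Equiv.apply_symm_apply]
      cases n with
      | zero => exact (MatchedPair.homogeneous_apply_self 0 (x 0)).symm
      | succ n =>
        exact (hx (n + 1) (by push_cast; omega)).trans
          (MatchedPair.homogeneous_apply_of_ne (by omega) (x 0)).symm
    rw [hx'] at hmc
    exact ⟨_, (key _).mp hmc, hx'.symm⟩
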